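/- Let $P$ be the uniform probability measure on $[0,1]$, let $1<p<\infty$, $\frac1p+\frac1q=1$ and $c>1$. For $Z\in L_p=L_p([0,1],P)$ put $$\rho(Z):=\inf_{t\in\mathbb R}\{t+c\,\|(Z-t)_+\|_p\}.$$ Let $F_Z(z)=P(Z\le z)$ and $F_Z^{-1}(\tau)=\sup\{t:F_Z(t)\le\tau\}$. A spectral function is a nonnegative, nondecreasing, right-continuous $\sigma:[0,1)\to\mathbb R$ with $\int_0^1\sigma=1$; put $\rho_\sigma(Z)=\int_0^1\sigma(u)F_Z^{-1}(u)\,du$ and $\Upsilon_c:=\{\sigma\text{ spectral}:\|\sigma\|_q=c\}$. Let $\mathfrak P$ be the set of probability measures on $[0,1]$ with zero mass at $1$, with the weak topology, and for $\mu\in\mathfrak P$ let $(\mathbb T\mu)(\tau)=\int_{[0,\tau]}(1-\alpha)^{-1}d\mu(\alpha)$, $\tau\in[0,1)$, a spectral function. A set $\mathfrak M\subset\mathfrak P$ is a Kusuoka set of $\rho$ if $\rho(Z)=\sup_{\mu\in\mathfrak M}\int \mathrm{AV@R}_\alpha(Z)\,d\mu(\alpha)$ for all $Z\in L_p$ (with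 finite integrals), where $\mathrm{AV@R}_\alpha(Z)=\inf_t\{t+(1-\alpha)^{-1}\mathbb E[Z-t]_+\}$; it is the minimal Kusuoka set if it is closed and contained in every closed Kusuoka set. The dual set of $\rho$ is $\mathfrak A=\{\zeta\in L_q:\int\zeta Z\,dP\le\rho(Z)\ \forall Z\in L_p\}$; a point $\zeta\in\mathfrak A$ is (weak$^*$) exposed if for some $Z\in L_p$ it is the unique maximizer of $\int\eta Z\,dP$ over $\eta\in\mathfrak A$. Then: 1. For every $Z\in L_p$ and $\sigma\in\Upsilon_c$ the integral $\rho_\sigma(Z)$ is finite, and $\rho(Z)=\sup\{\rho_\sigma(Z):\sigma\text{ spectral},\ \|\sigma\|_q=c\}$. 2. The spectral functions that are exposed points of $\mathfrak A$ are exactly the elements of $\Upsilon_c$; moreover, the exposed points of $\mathfrak A$ are exactly the $\zeta\in L_q$ that have the same distribution under $P$ as some $\sigma\in\Upsilon_c$. 3. This is the minimal Kusuoka representation of $\rho$: $\mathbb T^{-1}(\Upsilon_c)$ is a Kusuoka set of $\rho$, and its closure is the minimal Kusuoka set of $\rho$. -/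

import Mathlib

open MeasureTheory Set
open scoped ENNReal

namespace Kusuoka

/-- The uniform probability measure of the standard probability space `[0,1]`, viewed as a Borel
measure on `ℝ` carried by `[0,1]`. -/
noncomputable def stdP : Measure ℝ := volume.restrict (Icc 0 1)

instance stdP_isProbabilityMeasure : IsProbabilityMeasure stdP :=
  ⟨by simp [stdP]⟩

/-- `‖(Z - t)₊‖_p`. -/
noncomputable def posPartNorm (p : ℝ≥0∞) (Z : ℝ → ℝ) (t : ℝ) : ℝ :=
  (eLpNorm (fun ω => max (Z ω - t) 0) p stdP).toReal

/-- The higher order risk measure `ρ(Z) = inf_t {t + c ‖(Z - t)₊‖_p}` on `L_p`. -/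
noncomputable def higherOrderRisk (c : ℝ) (p : ℝ≥0∞) (Z : Lp ℝ p stdP) : ℝ :=
  ⨅ t : ℝ, (t + c * posPartNorm p Z t)

/-- The cumulative distribution function `F_Z(z) = P(Z ≤ z)`. -/
noncomputable def cdfOf (Z : ℝ → ℝ) (z : ℝ) : ℝ := stdP.real {ω | Z ω ≤ z}

/-- The right side quantile function `F_Z⁻¹(τ) = sup {t : F_Z(t) ≤ τ}`; it is used for
almost every `τ ∈ (0,1)` only, where the set is nonempty and bounded above. -/
noncomputable def quantile (Z : ℝ → ℝ) (τ : ℝ) : ℝ := sSup {t : ℝ | cdfOf Z t ≤ τ}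

/-- The (upper) Average Value-at-Risk at level `α ∈ [0,1)`. -/
noncomputable def avar (α : ℝ) (Z : ℝ → ℝ) : ℝ :=
  ⨅ t : ℝ, (t + (1 - α)⁻¹ * ∫ ω, max (Z ω - t) 0 ∂stdP)

/-- The infimum defining `higherOrderRisk` is over a set that is bounded below. -/
theorem bddBelow_higherOrderRisk (c : ℝ) (hc : 1 ≤ c) (p : ℝ≥0∞) (hp : 1 ≤ p)
    (Z : Lp ℝ p stdP) :
    BddBelow (range fun t : ℝ => t + c * posPartNorm p Z t) := by
  refine ⟨∫ ω, Z ω ∂stdP, ?_⟩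
  rintro _ ⟨t, rfl⟩
  have hZ : MemLp (Z : ℝ → ℝ) p stdP := Lp.memLp Z
  have hm : MemLp (fun ω => max (Z ω - t) 0) p stdP := (hZ.sub (memLp_const t)).pos_part
  have hi : Integrable (fun ω => max (Z ω - t) 0) stdP := hm.integrable hp
  have hZi : Integrable (Z : ℝ → ℝ) stdP := hZ.integrable hp
  have h1 : ∫ ω, max (Z ω - t) 0 ∂stdP ≤ posPartNorm p Z t := by
    have e : ∫ ω, max (Z ω - t) 0 ∂stdP
        = (eLpNorm (fun ω => max (Z ω - t) 0) 1 stdP).toReal := by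
      rw [eLpNorm_one_eq_lintegral_enorm, ← integral_norm_eq_lintegral_enorm hi.1]
      refine integral_congr_ae (Filter.Eventually.of_forall fun ω => ?_)
      simp [abs_of_nonneg (le_max_right (Z ω - t) 0)]
    rw [e]
    exact ENNReal.toReal_mono hm.2.ne (eLpNorm_le_eLpNorm_of_exponent_le hp hm.1)
  have h2 : ∫ ω, (Z ω - t) ∂stdP ≤ ∫ ω, max (Z ω - t) 0 ∂stdP :=
    integral_mono (hZi.sub (integrable_const t)) hi fun ω => le_max_left _ _
  rw [integral_sub hZi (integrable_const t)] at h2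
  simp at h2
  have h3 : 0 ≤ posPartNorm p Z t := ENNReal.toReal_nonneg
  change _ ≤ t + c * posPartNorm p Z t
  nlinarith

/-- The infimum defining `avar α Z` is over a set that is bounded below. -/
theorem bddBelow_avar (α : ℝ) (h0 : 0 ≤ α) (h1 : α < 1) (Z : ℝ → ℝ) (hZ : Integrable Z stdP) :
    BddBelow (range fun t : ℝ => t + (1 - α)⁻¹ * ∫ ω, max (Z ω - t) 0 ∂stdP) := by
  refine ⟨∫ ω, Z ω ∂stdP, ?_⟩
  rintro _ ⟨t, rfl⟩
  have hi : Integrable (fun ω => max (Z ω - t) 0) stdP := (hZ.sub (integrable_const t)).pos_part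
  have h2 : ∫ ω, (Z ω - t) ∂stdP ≤ ∫ ω, max (Z ω - t) 0 ∂stdP :=
    integral_mono (hZ.sub (integrable_const t)) hi fun ω => le_max_left _ _
  rw [integral_sub hZ (integrable_const t)] at h2
  simp at h2
  have h3 : 0 ≤ ∫ ω, max (Z ω - t) 0 ∂stdP := integral_nonneg fun ω => le_max_right _ _
  have h4 : 1 ≤ (1 - α)⁻¹ := (one_le_inv₀ (by linarith)).2 (by linarith)
  change _ ≤ t + (1 - α)⁻¹ * ∫ ω, max (Z ω - t) 0 ∂stdP
  nlinarith

/-- Spectral functions `σ : [0,1) → ℝ₊`: nonnegative, nondecreasing, right side continuous, with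
integral one. Values outside `[0,1)` are irrelevant. -/
structure IsSpectral (σ : ℝ → ℝ) : Prop where
  nonneg : ∀ τ ∈ Ico (0 : ℝ) 1, 0 ≤ σ τ
  mono : MonotoneOn σ (Ico 0 1)
  rightCont : ∀ τ ∈ Ico (0 : ℝ) 1, ContinuousWithinAt σ (Ici τ) τ
  integrable : IntegrableOn σ (Ico 0 1)
  integral_eq_one : ∫ τ in Ico (0 : ℝ) 1, σ τ = 1

/-- The spectral functions with `‖σ‖_q = c`. -/
def spectralSphere (c : ℝ) (q : ℝ≥0∞) : Set (ℝ → ℝ) :=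
  {σ | IsSpectral σ ∧ eLpNorm σ q stdP = ENNReal.ofReal c}

/-- The spectral risk measure `ρ_σ(Z) = ∫₀¹ σ(u) F_Z⁻¹(u) du`. -/
noncomputable def spectralRisk (σ Z : ℝ → ℝ) : ℝ :=
  ∫ u in Ioo (0 : ℝ) 1, σ u * quantile Z u

/-- The probability measures on `[0,1]` with zero mass at `1`, with the weak topology
(the subspace topology of `ProbabilityMeasure unitInterval`). -/
abbrev KMeasure : Type :=
  {μ : ProbabilityMeasure unitInterval // (μ : Measure unitInterval) {1} = 0}

/-- The measure underlying an element of `KMeasure`. -/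
noncomputable def KMeasure.meas (μ : KMeasure) : Measure unitInterval :=
  (μ.1 : Measure unitInterval)

/-- `M` is a Kusuoka set of `ρ : L_p → ℝ` : `ρ(Z) = sup_{μ ∈ M} ∫ AV@R_α(Z) dμ(α)` for all `Z`,
all these integrals being finite. -/
def IsKusuokaSet {p : ℝ≥0∞} (ρ : Lp ℝ p stdP → ℝ) (M : Set KMeasure) : Prop :=
  ∀ Z : Lp ℝ p stdP,
    (∀ μ ∈ M, Integrable (fun α : unitInterval => avar α Z) μ.meas) ∧
    IsLUB ((fun μ : KMeasure => ∫ α : unitInterval, avar α Z ∂μ.meas) '' M) (ρ Z)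

/-- A minimal Kusuoka set: a closed Kusuoka set contained in every closed Kusuoka set. -/
def IsMinimalKusuokaSet {p : ℝ≥0∞} (ρ : Lp ℝ p stdP → ℝ) (M : Set KMeasure) : Prop :=
  IsKusuokaSet ρ M ∧ IsClosed M ∧
    ∀ M' : Set KMeasure, IsKusuokaSet ρ M' → IsClosed M' → M ⊆ M'

/-- The map `(𝕋 μ)(τ) = ∫_{[0,τ]} (1 - α)⁻¹ dμ(α)`, for `τ ∈ [0,1)`. -/
noncomputable def spectrumOf (μ : KMeasure) (τ : ℝ) : ℝ :=
  ∫ α in {α : unitInterval | (α : ℝ) ≤ τ}, (1 - (α : ℝ))⁻¹ ∂μ.meas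

/-- The preimage `𝕋⁻¹(Υ)` of a set of spectral functions, which are compared on `[0,1)`. -/
def measuresOf (Υ : Set (ℝ → ℝ)) : Set KMeasure :=
  {μ | ∃ σ ∈ Υ, EqOn (spectrumOf μ) σ (Ico 0 1)}

/-- The pairing `⟨ζ, Z⟩ = ∫ ζ Z dP` of `L_q` with `L_p`. -/
noncomputable def pairing {p q : ℝ≥0∞} (ζ : Lp ℝ q stdP) (Z : Lp ℝ p stdP) : ℝ :=
  ∫ ω, ζ ω * Z ω ∂stdP

/-- The dual set of `ρ`, i.e. the largest `𝔄 ⊆ L_q` with `⟨ζ, Z⟩ ≤ ρ(Z)` for all `ζ ∈ 𝔄` and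
`Z ∈ L_p`: the weak* closed convex set of which `ρ` is the support function. -/
def dualSet {p : ℝ≥0∞} (q : ℝ≥0∞) (ρ : Lp ℝ p stdP → ℝ) : Set (Lp ℝ q stdP) :=
  {ζ | ∀ Z : Lp ℝ p stdP, pairing ζ Z ≤ ρ Z}

/-- Weak* exposed points of `A ⊆ L_q`: unique maximizers over `A` of `⟨·, Z⟩` for some
`Z ∈ L_p`. -/
def weakStarExposed (p : ℝ≥0∞) {q : ℝ≥0∞} (A : Set (Lp ℝ q stdP)) : Set (Lp ℝ q stdP) :=
  {ζ | ζ ∈ A ∧ ∃ Z : Lp ℝ p stdP, ∀ η ∈ A, η ≠ ζ → pairing η Z < pairing ζ Z}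

end Kusuoka

namespace Kusuoka

open ProbabilityTheory Filter Topology

/-! Duality. The dual set consists of the densities `ζ ≥ 0` with `∫ ζ = 1` and `‖ζ‖_q ≤ c`. Hölder's
inequality bounds the pairing of such a density with `Z` by every term `t + c‖(Z - t)₊‖_p`;
conversely, testing with constants, with `-1` on `{ζ < 0}` and with `ζ^(q-1)` forces the three
conditions (`mem_dualSet_iff`). If `‖ζ‖_q = c`, strict convexity of `x^q` shows that `ζ^(q-1)`
exposes `ζ`; if `‖ζ‖_q < c`, both `ζ + h` and `ζ - h` are admissible for some `h ≠ 0`, so nothing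
exposes `ζ`. These conditions depend only on the law of `ζ`, whose nondecreasing rearrangement is
its quantile function.

Attainment. Let `Q` be the quantile function of `Z`, `A(t) = ∫ (Q-t)₊^p` and `B(t) = ∫
(Q-t)₊^(p-1)`. Stationarity of `t + c A(t)^(1/p)` reads `A = (cB)^q`. The intermediate value theorem
solves it, and `(Q-t)₊^(p-1) / B(t)` is then a spectral function of norm `c` attaining the risk. In
the degenerate case `Q` is constant on the top tail of length `c^(-p)`, and the normalized indicator
of that tail serves (`exists_spectral_attaining`).

Kusuoka sets. By Fubini, `∫ AV@R_α(Z) dμ(α) = ∫ (𝕋μ) Q`, and `𝕋` maps onto the spectral functions,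
so the sphere yields a Kusuoka set. The bound `‖𝕋μ‖_q ≤ c` can be tested on bounded nondecreasing
functions, for which the pairing is weakly continuous in `μ`; hence the closure is a Kusuoka set
too.

Minimality. Let `M` be a closed Kusuoka set and `‖𝕋μ‖_q = c`. Its members have spectral norm at most
`c`, and some `ν n` in `M` maximize the pairing with `(𝕋μ)^(q-1)` in the limit. A perturbation
argument makes `𝕋(ν n)` converge weakly to `𝕋μ` (`tendsto_integral_mul`). Moments of a measure are
pairings with its spectral function, so `ν n → μ` weakly and `μ ∈ M`. -/

theorem stdP_eq_Ioo : stdP = volume.restrict (Ioo (0 : ℝ) 1) :=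
  (Measure.restrict_congr_set Ioo_ae_eq_Icc).symm

theorem stdP_eq_Ico : stdP = volume.restrict (Ico (0 : ℝ) 1) :=
  (Measure.restrict_congr_set Ico_ae_eq_Icc).symm

theorem ae_mem_Ioo : ∀ᵐ u ∂stdP, u ∈ Ioo (0 : ℝ) 1 := by
  rw [stdP_eq_Ioo]
  exact ae_restrict_mem measurableSet_Ioo

theorem ae_ne (a : ℝ) : ∀ᵐ u ∂stdP, u ≠ a := by
  have : ∀ᵐ u : ℝ, u ≠ a := by simp [ae_iff]
  exact ae_restrict_of_ae this

theorem stdP_Iio {x : ℝ} (h1 : x ≤ 1) : stdP (Iio x) = ENNReal.ofReal x := by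
  rw [stdP_eq_Ico, Measure.restrict_apply measurableSet_Iio]
  have : Iio x ∩ Ico 0 1 = Ico 0 x := by
    ext u
    simp only [mem_inter_iff, mem_Iio, mem_Ico]
    constructor
    · rintro ⟨h, h', _⟩
      exact ⟨h', h⟩
    · rintro ⟨h, h'⟩
      exact ⟨h', h, by linarith⟩
  simp [this]

theorem aemeasurable_of_monotoneOn {g : ℝ → ℝ} (hg : MonotoneOn g (Ioo 0 1)) :
    AEMeasurable g stdP := by
  rw [stdP_eq_Ioo]
  exact aemeasurable_restrict_of_monotoneOn measurableSet_Ioo hg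

theorem cdfOf_eq_cdf {Z : ℝ → ℝ} (hZ : AEMeasurable Z stdP) (x : ℝ) :
    cdfOf Z x = cdf (stdP.map Z) x := by
  have := Measure.isProbabilityMeasure_map hZ
  rw [cdf_eq_real, Measure.real, Measure.map_apply_of_aemeasurable hZ measurableSet_Iic]
  rfl

theorem cdfOf_congr {Z W : ℝ → ℝ} (h : Z =ᵐ[stdP] W) : cdfOf Z = cdfOf W := by
  ext x
  refine measureReal_congr ?_
  filter_upwards [h] with u hu
  change (Z u ≤ x) = (W u ≤ x)
  rw [hu]

theorem quantile_congr {Z W : ℝ → ℝ} (h : Z =ᵐ[stdP] W) : quantile Z = quantile W := by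
  ext τ
  rw [quantile, quantile, cdfOf_congr h]

theorem cdfOf_mono (Z : ℝ → ℝ) : Monotone (cdfOf Z) := fun x y hxy =>
  measureReal_mono fun _ h => le_trans (show Z _ ≤ x from h) hxy

theorem cdfOf_le_one (Z : ℝ → ℝ) (x : ℝ) : cdfOf Z x ≤ 1 := measureReal_le_one

/-! ### Quantile functions and nondecreasing rearrangement -/

section Quantile

variable {Z : ℝ → ℝ} {τ x : ℝ}

theorem bddAbove_cdfOf_le (hZ : AEMeasurable Z stdP) (hτ : τ < 1) :
    BddAbove {t : ℝ | cdfOf Z t ≤ τ} := by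
  have h : Tendsto (cdfOf Z) atTop (𝓝 1) :=
    (tendsto_cdf_atTop (stdP.map Z)).congr fun x => (cdfOf_eq_cdf hZ x).symm
  obtain ⟨x, hx⟩ := (h.eventually (lt_mem_nhds hτ)).exists
  refine ⟨x, fun t ht => ?_⟩
  by_contra! hxt
  exact absurd (cdfOf_mono Z hxt.le) (not_le.2 (lt_of_le_of_lt ht hx))

theorem nonempty_cdfOf_le (hZ : AEMeasurable Z stdP) (hτ : 0 < τ) :
    {t : ℝ | cdfOf Z t ≤ τ}.Nonempty := by
  have h : Tendsto (cdfOf Z) atBot (𝓝 0) :=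
    (tendsto_cdf_atBot (stdP.map Z)).congr fun x => (cdfOf_eq_cdf hZ x).symm
  obtain ⟨x, hx⟩ := (h.eventually (gt_mem_nhds hτ)).exists
  exact ⟨x, le_of_lt hx⟩

theorem cdfOf_neg_eq_zero (h0 : ∀ᵐ u ∂stdP, 0 ≤ Z u) (hx : x < 0) : cdfOf Z x = 0 := by
  rw [cdfOf, measureReal_def, ENNReal.toReal_eq_zero_iff]
  left
  refine measure_mono_null (fun u hu => ?_) (ae_iff.1 h0)
  simp only [mem_ofPred_eq] at hu ⊢
  linarith

/-- For `Z` unbounded below the set is empty at `τ = 0` and `sSup` takes a default value.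
Nonnegativity excludes this, so the quantile function behaves well on all of `[0,1)`, as a spectral
function must. -/
theorem nonempty_cdfOf_le_of_nonneg (h0 : ∀ᵐ u ∂stdP, 0 ≤ Z u) (hτ : 0 ≤ τ) :
    {t : ℝ | cdfOf Z t ≤ τ}.Nonempty :=
  ⟨-1, by simpa [cdfOf_neg_eq_zero h0 (show (-1 : ℝ) < 0 by norm_num)] using hτ⟩

theorem quantile_le (hne : {t : ℝ | cdfOf Z t ≤ τ}.Nonempty) (h : τ < cdfOf Z x) :
    quantile Z τ ≤ x := by
  refine csSup_le hne fun t ht => ?_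
  by_contra! hxt
  exact absurd (cdfOf_mono Z hxt.le) (not_le.2 (lt_of_le_of_lt ht h))

theorem lt_cdfOf (hZ : AEMeasurable Z stdP) (hτ : τ < 1) (h : quantile Z τ < x) :
    τ < cdfOf Z x := by
  have := notMem_of_csSup_lt h (bddAbove_cdfOf_le hZ hτ)
  simpa using this

theorem quantile_le_quantile (hZ : AEMeasurable Z stdP) {τ' : ℝ}
    (hne : {t : ℝ | cdfOf Z t ≤ τ}.Nonempty) (h : τ ≤ τ') (hτ : τ' < 1) :
    quantile Z τ ≤ quantile Z τ' :=
  csSup_le_csSup (bddAbove_cdfOf_le hZ hτ) hne fun _ ht => le_trans ht h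

theorem monotoneOn_quantile (hZ : AEMeasurable Z stdP) : MonotoneOn (quantile Z) (Ioo 0 1) :=
  fun _ h _ h' hh => quantile_le_quantile hZ (nonempty_cdfOf_le hZ h.1) hh h'.2

theorem monotoneOn_quantile_of_nonneg (hZ : AEMeasurable Z stdP) (h0 : ∀ᵐ u ∂stdP, 0 ≤ Z u) :
    MonotoneOn (quantile Z) (Ico 0 1) :=
  fun _ h _ h' hh => quantile_le_quantile hZ (nonempty_cdfOf_le_of_nonneg h0 h.1) hh h'.2

theorem continuousWithinAt_quantile (hZ : AEMeasurable Z stdP)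
    (hne : {t : ℝ | cdfOf Z t ≤ τ}.Nonempty) (hτ : τ < 1) :
    ContinuousWithinAt (quantile Z) (Ici τ) τ := by
  rw [ContinuousWithinAt, tendsto_order]
  constructor
  · intro a ha
    filter_upwards [self_mem_nhdsWithin, mem_nhdsWithin_of_mem_nhds (Iio_mem_nhds hτ)] with u hu hu'
    exact ha.trans_le (quantile_le_quantile hZ hne hu hu')
  · intro a ha
    obtain ⟨y, hy, hya⟩ := exists_between ha
    filter_upwards [self_mem_nhdsWithin,
      mem_nhdsWithin_of_mem_nhds (Iio_mem_nhds (lt_cdfOf hZ hτ hy))] with u hu hu'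
    refine (quantile_le ?_ hu').trans_lt hya
    obtain ⟨t, ht⟩ := hne
    have ht' : cdfOf Z t ≤ τ := ht
    have hu'' : τ ≤ u := hu
    exact ⟨t, ht'.trans hu''⟩

theorem aemeasurable_quantile (hZ : AEMeasurable Z stdP) : AEMeasurable (quantile Z) stdP :=
  aemeasurable_of_monotoneOn (monotoneOn_quantile hZ)

theorem identDistrib_quantile (hZ : AEMeasurable Z stdP) :
    IdentDistrib (quantile Z) Z stdP stdP := by
  refine ⟨aemeasurable_quantile hZ, hZ, ?_⟩
  have := Measure.isProbabilityMeasure_map (aemeasurable_quantile hZ)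
  refine Measure.ext_of_Iic _ _ fun x => ?_
  rw [Measure.map_apply_of_aemeasurable (aemeasurable_quantile hZ) measurableSet_Iic,
    Measure.map_apply_of_aemeasurable hZ measurableSet_Iic]
  -- The two events can differ only at the single point `u = cdfOf Z x`.
  have h1 : quantile Z ⁻¹' Iic x =ᵐ[stdP] Iio (cdfOf Z x) := by
    filter_upwards [ae_mem_Ioo, ae_ne (cdfOf Z x)] with u hu hne
    refine propext ⟨fun h => ?_, fun h => quantile_le (nonempty_cdfOf_le hZ hu.1) h⟩
    have h' : quantile Z u ≤ x := h
    have hr : ContinuousWithinAt (cdfOf Z) (Ioi x) x := by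
      have : cdfOf Z = cdf (stdP.map Z) := funext (cdfOf_eq_cdf hZ)
      rw [this]
      exact ((cdf (stdP.map Z)).right_continuous x).mono Ioi_subset_Ici_self
    have : u ≤ cdfOf Z x := by
      refine ge_of_tendsto hr ?_
      filter_upwards [self_mem_nhdsWithin] with y hy
      exact (lt_cdfOf hZ hu.2 (h'.trans_lt hy)).le
    exact lt_of_le_of_ne this hne
  rw [measure_congr h1, stdP_Iio (cdfOf_le_one _ _), cdfOf,
    ofReal_measureReal]
  rfl

/-- A nondecreasing right-continuous function is its own quantile function. -/
theorem quantile_eq_self (hm : MonotoneOn Z (Ioo 0 1))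
    (hr : ∀ u ∈ Ioo (0 : ℝ) 1, ContinuousWithinAt Z (Ici u) u) (hτ : τ ∈ Ioo (0 : ℝ) 1) :
    quantile Z τ = Z τ := by
  have hZ := aemeasurable_of_monotoneOn hm
  refine le_antisymm ?_ ?_
  · refine le_of_forall_gt_imp_ge_of_dense fun a ha => ?_
    refine quantile_le (nonempty_cdfOf_le hZ hτ.1) ?_
    -- Right continuity gives `u > τ` with `Z u < a`. Then `Z < a` on `(0,u)`, so the distribution
    -- function at `a` is at least `u > τ`.
    have h1 : ∀ᶠ u in 𝓝[>] τ, Z u < a ∧ u < 1 :=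
      (((hr τ hτ).mono Ioi_subset_Ici_self).eventually (gt_mem_nhds ha)).and
        (mem_nhdsWithin_of_mem_nhds (Iio_mem_nhds hτ.2))
    obtain ⟨u, ⟨hu, hu1⟩, hτu⟩ := (h1.and self_mem_nhdsWithin).exists
    have hτu' : τ < u := hτu
    refine hτu'.trans_le ?_
    have hu0 : 0 < u := hτ.1.trans hτu'
    rw [cdfOf, measureReal_def, ← ENNReal.ofReal_le_iff_le_toReal (measure_ne_top _ _),
      ← stdP_Iio hu1.le]
    refine measure_mono_ae ?_
    filter_upwards [ae_mem_Ioo] with v hv hvu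
    exact (hm hv ⟨hu0, hu1⟩ (le_of_lt hvu)).trans hu.le
  · refine le_of_forall_lt_imp_le_of_dense fun a ha => ?_
    refine le_csSup (bddAbove_cdfOf_le hZ hτ.2) ?_
    change cdfOf Z a ≤ τ
    rw [cdfOf, measureReal_def]
    refine ENNReal.toReal_le_of_le_ofReal hτ.1.le ?_
    rw [← stdP_Iio hτ.2.le]
    refine measure_mono_ae ?_
    filter_upwards [ae_mem_Ioo] with v hv hva
    by_contra! hvu
    have hva' : Z v ≤ a := hva
    have := hm hτ hv (not_lt.1 hvu)
    linarith

theorem quantile_nonneg (hZ : AEMeasurable Z stdP) (h0 : ∀ᵐ u ∂stdP, 0 ≤ Z u)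
    (hτ : τ ∈ Ico (0 : ℝ) 1) : 0 ≤ quantile Z τ := by
  refine le_of_forall_lt_imp_le_of_dense fun a ha => ?_
  refine le_csSup (bddAbove_cdfOf_le hZ hτ.2) ?_
  change cdfOf Z a ≤ τ
  rw [cdfOf_neg_eq_zero h0 ha]
  exact hτ.1

theorem isSpectral_quantile (hZ : Integrable Z stdP) (h0 : ∀ᵐ u ∂stdP, 0 ≤ Z u)
    (h1 : ∫ u, Z u ∂stdP = 1) : IsSpectral (quantile Z) := by
  have hm := hZ.aemeasurable
  have hI := identDistrib_quantile hm
  refine ⟨fun τ hτ => quantile_nonneg hm h0 hτ, monotoneOn_quantile_of_nonneg hm h0,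
    fun τ hτ => continuousWithinAt_quantile hm (nonempty_cdfOf_le_of_nonneg h0 hτ.1) hτ.2, ?_, ?_⟩
  · rw [IntegrableOn, ← stdP_eq_Ico]
    exact hI.integrable_iff.2 hZ
  · rw [← stdP_eq_Ico, hI.integral_eq, h1]

end Quantile

/-! ### Average Value-at-Risk as a tail average of the quantile function -/

section AVaR

variable {Z : ℝ → ℝ} {α : ℝ}

theorem integrable_quantile (hZ : Integrable Z stdP) : Integrable (quantile Z) stdP :=
  (identDistrib_quantile hZ.aemeasurable).integrable_iff.2 hZ

theorem integral_posPart_eq_quantile (hZ : AEMeasurable Z stdP) (t : ℝ) :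
    ∫ ω, max (Z ω - t) 0 ∂stdP = ∫ u, max (quantile Z u - t) 0 ∂stdP :=
  ((identDistrib_quantile hZ).comp (u := fun x => max (x - t) 0) (by fun_prop)).integral_eq.symm

theorem stdP_restrict_Ici (h0 : 0 ≤ α) : stdP.restrict (Ici α) = volume.restrict (Ioo α 1) := by
  rw [stdP, Measure.restrict_restrict measurableSet_Ici]
  have : Ici α ∩ Icc 0 1 = Icc α 1 := by
    ext u
    simp only [mem_inter_iff, mem_Ici, mem_Icc]
    constructor
    · rintro ⟨h, _, h'⟩
      exact ⟨h, h'⟩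
    · rintro ⟨h, h'⟩
      exact ⟨h, h0.trans h, h'⟩
  rw [this]
  exact Measure.restrict_congr_set Ioo_ae_eq_Icc.symm

theorem le_avar_term (h0 : 0 ≤ α) (h1 : α < 1) (hZ : Integrable Z stdP) (t : ℝ) :
    (1 - α)⁻¹ * ∫ u in Ioo α 1, quantile Z u ≤
      t + (1 - α)⁻¹ * ∫ ω, max (Z ω - t) 0 ∂stdP := by
  rw [integral_posPart_eq_quantile hZ.aemeasurable]
  have hQ := integrable_quantile hZ
  have hi : Integrable (fun u => max (quantile Z u - t) 0) stdP :=
    (hQ.sub (integrable_const t)).pos_part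
  have hQ' : Integrable (quantile Z) (volume.restrict (Ioo α 1)) := by
    rw [← stdP_restrict_Ici h0]
    exact hQ.restrict
  have e1 : ∫ u in Ici α, max (quantile Z u - t) 0 ∂stdP ≤
      ∫ u, max (quantile Z u - t) 0 ∂stdP :=
    setIntegral_le_integral hi (Eventually.of_forall fun u => le_max_right _ _)
  have e2 : ∫ u in Ioo α 1, (quantile Z u - t) ≤
      ∫ u in Ici α, max (quantile Z u - t) 0 ∂stdP := by
    rw [← stdP_restrict_Ici h0]
    exact integral_mono (hQ.restrict.sub (integrable_const t)) hi.restrict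
      fun u => le_max_left _ _
  rw [integral_sub hQ' (integrable_const t)] at e2
  simp only [integral_const, MeasurableSet.univ, measureReal_restrict_apply, univ_inter,
    Real.volume_real_Ioo_of_le h1.le, smul_eq_mul] at e2
  have h : 0 < 1 - α := by linarith
  rw [inv_mul_le_iff₀ h, mul_add, mul_inv_cancel_left₀ h.ne']
  linarith

/-- For `α > 0` the infimum is attained at `t = quantile Z α`, because `(Q - t)₊` then vanishes to
the left of `α` and equals `Q - t` to the right. -/
theorem avar_eq_integral_quantile (h0 : 0 ≤ α) (h1 : α < 1) (hZ : Integrable Z stdP) :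
    avar α Z = (1 - α)⁻¹ * ∫ u in Ioo α 1, quantile Z u := by
  have hQ := integrable_quantile hZ
  have hbdd := bddBelow_avar α h0 h1 Z hZ
  refine le_antisymm ?_ (le_ciInf fun t => le_avar_term h0 h1 hZ t)
  rcases h0.eq_or_lt with rfl | h0'
  -- At `α = 0` the infimum need not be attained. Along `t = -n` the term equals `∫ max Q (-n)`,
  -- which tends to `∫ Q`.
  · have hlim : Tendsto (fun n : ℕ => ∫ u, max (quantile Z u) (-(n : ℝ)) ∂stdP) atTop
        (𝓝 (∫ u, quantile Z u ∂stdP)) := by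
      refine tendsto_integral_of_dominated_convergence (fun u => |quantile Z u|)
        (fun n => (hQ.aestronglyMeasurable.aemeasurable.max
          aemeasurable_const).aestronglyMeasurable) hQ.abs
        (fun n => Eventually.of_forall fun u => ?_) (Eventually.of_forall fun u => ?_)
      · rw [Real.norm_eq_abs, abs_le]
        have hn : (0 : ℝ) ≤ n := n.cast_nonneg
        exact ⟨(neg_abs_le _).trans (le_max_left _ _),
          max_le (le_abs_self _) (by linarith [abs_nonneg (quantile Z u)])⟩
      · obtain ⟨N, hN⟩ := exists_nat_gt (-quantile Z u)
        refine tendsto_const_nhds.congr' ?_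
        filter_upwards [eventually_ge_atTop N] with n hn
        have : (N : ℝ) ≤ n := by exact_mod_cast hn
        rw [max_eq_left]
        linarith
    rw [sub_zero, inv_one, one_mul, ← stdP_eq_Ioo]
    refine ge_of_tendsto' hlim fun n => ?_
    refine (ciInf_le hbdd (-(n : ℝ))).trans (le_of_eq ?_)
    rw [integral_posPart_eq_quantile hZ.aemeasurable]
    have : ∀ u, max (quantile Z u) (-(n : ℝ)) = -(n : ℝ) + max (quantile Z u - -(n : ℝ)) 0 := by
      intro u
      rw [← max_add_add_left]
      simp
    simp_rw [this]
    have hi : Integrable (fun u => max (quantile Z u - -(n : ℝ)) 0) stdP :=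
      (hQ.sub (integrable_const _)).pos_part
    rw [integral_add (integrable_const _) hi]
    simp
  · refine (ciInf_le hbdd (quantile Z α)).trans (le_of_eq ?_)
    rw [integral_posPart_eq_quantile hZ.aemeasurable]
    have hm := monotoneOn_quantile hZ.aemeasurable
    have e : ∫ u, max (quantile Z u - quantile Z α) 0 ∂stdP =
        ∫ u in Ioo α 1, (quantile Z u - quantile Z α) := by
      rw [← stdP_restrict_Ici h0, ← integral_indicator measurableSet_Ici]
      refine integral_congr_ae ?_
      filter_upwards [ae_mem_Ioo] with u hu
      by_cases hau : α ≤ u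
      · rw [indicator_of_mem (show u ∈ Ici α from hau), max_eq_left]
        linarith [hm ⟨h0', h1⟩ hu hau]
      · rw [indicator_of_notMem (show u ∉ Ici α from hau), max_eq_right]
        linarith [hm hu ⟨h0', h1⟩ (not_le.1 hau).le]
    have hQ' : Integrable (quantile Z) (volume.restrict (Ioo α 1)) := by
      rw [← stdP_restrict_Ici h0]
      exact hQ.restrict
    rw [e, integral_sub hQ' (integrable_const _)]
    simp only [integral_const, MeasurableSet.univ, measureReal_restrict_apply, univ_inter,
      Real.volume_real_Ioo_of_le h1.le, smul_eq_mul]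
    have h : 1 - α ≠ 0 := by linarith
    field_simp
    ring

end AVaR

/-! ### The map from measures to spectral functions -/

section Spectrum

variable (μ : KMeasure)

instance : IsProbabilityMeasure μ.meas := by
  unfold KMeasure.meas
  infer_instance

theorem KMeasure.ae_lt_one : ∀ᵐ α : unitInterval ∂μ.meas, (α : ℝ) < 1 := by
  have h : μ.meas {1} = 0 := μ.2
  have : ∀ᵐ α : unitInterval ∂μ.meas, α ≠ 1 := by
    rw [ae_iff]
    simpa using h
  filter_upwards [this] with α hα
  exact lt_of_le_of_ne α.2.2 fun h => hα (Subtype.ext h)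

theorem measurableSet_coe_le (u : ℝ) : MeasurableSet {α : unitInterval | (α : ℝ) ≤ u} :=
  measurableSet_le measurable_subtype_coe measurable_const

theorem inv_one_sub_nonneg (α : unitInterval) : 0 ≤ (1 - (α : ℝ))⁻¹ :=
  inv_nonneg.2 (by linarith [α.2.2])

theorem inv_one_sub_le {u : ℝ} (hu : u < 1) {α : ℝ} (hα : α ≤ u) :
    (1 - α)⁻¹ ≤ (1 - u)⁻¹ :=
  inv_anti₀ (by linarith) (by linarith)

theorem integrableOn_inv_one_sub {u : ℝ} (hu : u < 1) :
    IntegrableOn (fun α : unitInterval => (1 - (α : ℝ))⁻¹) {α | (α : ℝ) ≤ u} μ.meas := by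
  refine Measure.integrableOn_of_bounded (M := (1 - u)⁻¹) (measure_ne_top _ _)
    (Measurable.aestronglyMeasurable (by fun_prop)) ?_
  filter_upwards [ae_restrict_mem (measurableSet_coe_le u)] with α hα
  rw [Real.norm_of_nonneg (inv_one_sub_nonneg α)]
  exact inv_one_sub_le hu hα

theorem spectrumOf_nonneg (u : ℝ) : 0 ≤ spectrumOf μ u :=
  integral_nonneg fun α => inv_one_sub_nonneg α

theorem monotoneOn_spectrumOf : MonotoneOn (spectrumOf μ) (Ico 0 1) := by
  intro u _ v hv huv
  refine setIntegral_mono_set (integrableOn_inv_one_sub μ hv.2)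
    (Eventually.of_forall fun α => inv_one_sub_nonneg α) (Eventually.of_forall ?_)
  intro α hα
  exact le_trans (show (α : ℝ) ≤ u from hα) huv

/-- The indicator of `{α ≤ w}` is right-continuous in `w`, and for `w < v < 1` the integrand is
bounded by `(1 - v)⁻¹`. -/
theorem continuousWithinAt_spectrumOf {u : ℝ} (hu : u < 1) :
    ContinuousWithinAt (spectrumOf μ) (Ici u) u := by
  obtain ⟨v, huv, hv⟩ := exists_between hu
  have e : ∀ w, spectrumOf μ w = ∫ α, {α : unitInterval | (α : ℝ) ≤ w}.indicator
      (fun α => (1 - (α : ℝ))⁻¹) α ∂μ.meas := fun w =>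
    (integral_indicator (measurableSet_coe_le w)).symm
  have e' : spectrumOf μ = fun w => ∫ α, {α : unitInterval | (α : ℝ) ≤ w}.indicator
      (fun α => (1 - (α : ℝ))⁻¹) α ∂μ.meas := funext e
  rw [e']
  refine continuousWithinAt_of_dominated (bound := fun _ => (1 - v)⁻¹) ?_ ?_
    (integrable_const _) ?_
  · refine Eventually.of_forall fun w => Measurable.aestronglyMeasurable ?_
    exact Measurable.indicator (by fun_prop) (measurableSet_coe_le w)
  · filter_upwards [mem_nhdsWithin_of_mem_nhds (Iio_mem_nhds huv)] with w hw
    refine Eventually.of_forall fun α => ?_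
    have hv0 : 0 ≤ (1 - v)⁻¹ := inv_nonneg.2 (by linarith)
    by_cases h : (α : ℝ) ≤ w
    · rw [indicator_of_mem (show α ∈ {α : unitInterval | (α : ℝ) ≤ w} from h),
        Real.norm_of_nonneg (inv_one_sub_nonneg α)]
      exact inv_one_sub_le hv (h.trans (le_of_lt hw))
    · rw [indicator_of_notMem (show α ∉ {α : unitInterval | (α : ℝ) ≤ w} from h)]
      simpa using hv0
  · refine Eventually.of_forall fun α => ?_
    refine tendsto_const_nhds.congr' ?_
    by_cases h : (α : ℝ) ≤ u
    · filter_upwards [self_mem_nhdsWithin] with w hw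
      rw [indicator_of_mem (show α ∈ {α : unitInterval | (α : ℝ) ≤ w} from h.trans hw),
        indicator_of_mem (show α ∈ {α : unitInterval | (α : ℝ) ≤ u} from h)]
    · filter_upwards [mem_nhdsWithin_of_mem_nhds (Iio_mem_nhds (not_le.1 h))] with w hw
      rw [indicator_of_notMem (show α ∉ {α : unitInterval | (α : ℝ) ≤ w} from fun h' =>
        absurd (show (α : ℝ) ≤ w from h') (not_le.2 hw)),
        indicator_of_notMem (show α ∉ {α : unitInterval | (α : ℝ) ≤ u} from h)]

/-- The kernel `1_{α ≤ u} (1 - α)⁻¹ Q(u)` linking a measure with its spectral function. -/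
noncomputable def spectrumKernel (Q : ℝ → ℝ) (x : unitInterval × ℝ) : ℝ :=
  {x : unitInterval × ℝ | (x.1 : ℝ) ≤ x.2}.indicator (fun x => (1 - (x.1 : ℝ))⁻¹ * Q x.2) x

theorem aestronglyMeasurable_spectrumKernel {Q : ℝ → ℝ} (hQ : AEStronglyMeasurable Q stdP) :
    AEStronglyMeasurable (spectrumKernel Q) (μ.meas.prod stdP) := by
  refine AEStronglyMeasurable.indicator ?_
    (measurableSet_le (by fun_prop) measurable_snd)
  exact (Measurable.aestronglyMeasurable (by fun_prop)).mul hQ.comp_snd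

theorem spectrumKernel_eq_fst (Q : ℝ → ℝ) (α : unitInterval) :
    (fun u => spectrumKernel Q (α, u)) =
      (Ici (α : ℝ)).indicator fun u => (1 - (α : ℝ))⁻¹ * Q u := rfl

theorem spectrumKernel_eq_snd (Q : ℝ → ℝ) (u : ℝ) :
    (fun α => spectrumKernel Q (α, u)) =
      {α : unitInterval | (α : ℝ) ≤ u}.indicator fun α => (1 - (α : ℝ))⁻¹ * Q u := rfl

theorem integral_spectrumKernel_fst (Q : ℝ → ℝ) (α : unitInterval) :
    ∫ u, spectrumKernel Q (α, u) ∂stdP = (1 - (α : ℝ))⁻¹ * ∫ u in Ioo (α : ℝ) 1, Q u := by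
  rw [spectrumKernel_eq_fst, integral_indicator measurableSet_Ici, stdP_restrict_Ici α.2.1,
    integral_const_mul]

theorem integral_spectrumKernel_snd (Q : ℝ → ℝ) (u : ℝ) :
    ∫ α, spectrumKernel Q (α, u) ∂μ.meas = spectrumOf μ u * Q u := by
  rw [spectrumKernel_eq_snd, integral_indicator (measurableSet_coe_le u), integral_mul_const]
  rfl

theorem norm_spectrumKernel (Q : ℝ → ℝ) (x : unitInterval × ℝ) :
    ‖spectrumKernel Q x‖ = spectrumKernel (fun u => |Q u|) x := by
  unfold spectrumKernel
  by_cases h : x ∈ {x : unitInterval × ℝ | (x.1 : ℝ) ≤ x.2}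
  · rw [indicator_of_mem h, indicator_of_mem h, norm_mul,
      Real.norm_of_nonneg (inv_one_sub_nonneg x.1), Real.norm_eq_abs]
  · rw [indicator_of_notMem h, indicator_of_notMem h, norm_zero]

/-- Fubini for the kernel with `Q = 1`: the inner integral over `u` is `(1-α)⁻¹(1-α) = 1` for almost
every `α`, since `μ` has no mass at `1`. -/
theorem integrable_spectrumOf : Integrable (spectrumOf μ) stdP ∧ ∫ u, spectrumOf μ u ∂stdP = 1 := by
  have hone : (fun α : unitInterval => (1 - (α : ℝ))⁻¹ * ∫ _ in Ioo (α : ℝ) 1, (1 : ℝ)) =ᵐ[μ.meas]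
      fun _ => 1 := by
    filter_upwards [μ.ae_lt_one] with α hα
    have : 1 - (α : ℝ) ≠ 0 := by linarith
    simp [Real.volume_real_Ioo_of_le hα.le, this]
  have hi : Integrable (spectrumKernel fun _ => 1) (μ.meas.prod stdP) := by
    rw [integrable_prod_iff (aestronglyMeasurable_spectrumKernel μ aestronglyMeasurable_const)]
    constructor
    · refine Eventually.of_forall fun α => ?_
      rw [spectrumKernel_eq_fst]
      exact (integrable_const _).indicator measurableSet_Ici
    · simp only [norm_spectrumKernel, integral_spectrumKernel_fst, abs_one]
      exact (integrable_const (1 : ℝ)).congr hone.symm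
  have h1 := hi.integral_prod_right
  simp only [integral_spectrumKernel_snd, mul_one] at h1
  refine ⟨h1, ?_⟩
  have h2 := integral_integral_swap (f := fun α u => spectrumKernel (fun _ => 1) (α, u)) hi
  simp only [integral_spectrumKernel_snd, integral_spectrumKernel_fst, mul_one] at h2
  rw [← h2, integral_congr_ae hone]
  simp

theorem isSpectral_spectrumOf : IsSpectral (spectrumOf μ) := by
  refine ⟨fun u _ => spectrumOf_nonneg μ u, monotoneOn_spectrumOf μ,
    fun u hu => continuousWithinAt_spectrumOf μ hu.2, ?_, ?_⟩
  · rw [IntegrableOn, ← stdP_eq_Ico]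
    exact (integrable_spectrumOf μ).1
  · rw [← stdP_eq_Ico]
    exact (integrable_spectrumOf μ).2

/-- Fubini turns a mixture of tail averages into a pairing with the spectral function. The weight is
nonnegative, so absolute values fall on `Q` only and the hypothesis is exactly integrability of the
kernel. -/
theorem integral_spectrumOf_mul {Q : ℝ → ℝ} (hQ : AEStronglyMeasurable Q stdP)
    (hi : Integrable (fun u => spectrumOf μ u * Q u) stdP) :
    Integrable (fun α : unitInterval => (1 - (α : ℝ))⁻¹ * ∫ u in Ioo (α : ℝ) 1, Q u) μ.meas ∧
      ∫ α : unitInterval, ((1 - (α : ℝ))⁻¹ * ∫ u in Ioo (α : ℝ) 1, Q u) ∂μ.meas =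
        ∫ u, spectrumOf μ u * Q u ∂stdP := by
  have hK : Integrable (spectrumKernel Q) (μ.meas.prod stdP) := by
    rw [integrable_prod_iff' (aestronglyMeasurable_spectrumKernel μ hQ)]
    constructor
    · filter_upwards [ae_mem_Ioo] with u hu
      rw [spectrumKernel_eq_snd, integrable_indicator_iff (measurableSet_coe_le u)]
      exact (integrableOn_inv_one_sub μ hu.2).mul_const _
    · simp only [norm_spectrumKernel, integral_spectrumKernel_snd]
      refine hi.norm.congr (Eventually.of_forall fun u => ?_)
      simp [abs_of_nonneg (spectrumOf_nonneg μ u)]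
  have h1 := hK.integral_prod_left
  simp only [integral_spectrumKernel_fst] at h1
  refine ⟨h1, ?_⟩
  have h2 := integral_integral_swap (f := fun α u => spectrumKernel Q (α, u)) hK
  simpa only [integral_spectrumKernel_snd, integral_spectrumKernel_fst] using h2

end Spectrum

/-! ### Every spectral function comes from a measure -/

section Surjectivity

variable {σ : ℝ → ℝ}

/-- The levels `α` with `y ≤ σ(α)`, together with `1`. -/
def levelSet (σ : ℝ → ℝ) (y : ℝ) : Set unitInterval :=
  {α | (α : ℝ) < 1 → y ≤ σ α}

/-- The generalized inverse of a spectral function. -/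
noncomputable def spectralInverse (σ : ℝ → ℝ) (y : ℝ) : unitInterval := sInf (levelSet σ y)

theorem monotone_spectralInverse (σ : ℝ → ℝ) : Monotone (spectralInverse σ) := fun _ _ h =>
  sInf_le_sInf fun _ hα h1 => h.trans (hα h1)

/-- The Galois connection of a generalized inverse. Monotonicity handles every level above `τ`, and
right continuity passes to `τ` itself. -/
theorem spectralInverse_le_iff (hσ : IsSpectral σ) {y τ : ℝ} (hτ : τ ∈ Ico (0 : ℝ) 1) :
    (spectralInverse σ y : ℝ) ≤ τ ↔ y ≤ σ τ := by
  constructor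
  · intro h
    have hr : Tendsto σ (𝓝[>] τ) (𝓝 (σ τ)) :=
      (hσ.rightCont τ hτ).mono Ioi_subset_Ici_self
    refine ge_of_tendsto hr ?_
    filter_upwards [self_mem_nhdsWithin, mem_nhdsWithin_of_mem_nhds (Iio_mem_nhds hτ.2)]
      with v hv hv1
    have hv' : τ < v := hv
    have hv1' : v < 1 := hv1
    have hlt : spectralInverse σ y < (⟨v, hτ.1.trans hv'.le, hv1'.le⟩ : unitInterval) :=
      Subtype.coe_lt_coe.1 (h.trans_lt hv')
    obtain ⟨α, hα, hαv⟩ := sInf_lt_iff.1 hlt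
    have hαv' : (α : ℝ) < v := hαv
    exact (hα (hαv'.trans hv1')).trans
      (hσ.mono ⟨α.2.1, hαv'.trans hv1'⟩ ⟨hτ.1.trans hv'.le, hv1'⟩ hαv'.le)
  · intro h
    have : spectralInverse σ y ≤ (⟨τ, hτ.1, hτ.2.le⟩ : unitInterval) := sInf_le fun _ => h
    exact this

/-- The measure `dσ` on `[0,1]`. -/
noncomputable def stieltjes (σ : ℝ → ℝ) : Measure unitInterval :=
  (volume.restrict (Ioi 0)).map (spectralInverse σ)

instance : SFinite (stieltjes σ) := by
  unfold stieltjes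
  infer_instance

/-- The heights `y > 0` sent to `[0, τ]` are exactly `(0, σ τ]`. In particular the jump from `0` to
`σ 0` becomes an atom at `α = 0`. -/
theorem stieltjes_apply (hσ : IsSpectral σ) {τ : ℝ} (hτ : τ ∈ Ico (0 : ℝ) 1) :
    stieltjes σ {α | (α : ℝ) ≤ τ} = ENNReal.ofReal (σ τ) := by
  rw [stieltjes, Measure.map_apply (monotone_spectralInverse σ).measurable
    (measurableSet_coe_le τ), Measure.restrict_apply
    ((monotone_spectralInverse σ).measurable (measurableSet_coe_le τ))]
  have : spectralInverse σ ⁻¹' {α | (α : ℝ) ≤ τ} ∩ Ioi 0 = Ioc 0 (σ τ) := by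
    ext y
    have := spectralInverse_le_iff hσ hτ (y := y)
    constructor
    · rintro ⟨h, h0⟩
      exact ⟨h0, this.1 h⟩
    · rintro ⟨h0, h⟩
      exact ⟨this.2 h, h0⟩
  rw [this, Real.volume_Ioc, sub_zero]

/-- The measure `(1 - α) dσ(α)`. -/
noncomputable def preKusuoka (σ : ℝ → ℝ) : Measure unitInterval :=
  (stieltjes σ).withDensity fun α => ENNReal.ofReal (1 - (α : ℝ))

theorem measurable_ofReal_one_sub :
    Measurable fun α : unitInterval => ENNReal.ofReal (1 - (α : ℝ)) := by fun_prop

/-- Since `1 - α` is the probability of `{u ≥ α}`, Tonelli rewrites the total mass as the integral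
over `u` of the mass `σ u` of `{α ≤ u}`. -/
theorem preKusuoka_univ (hσ : IsSpectral σ) : preKusuoka σ univ = 1 := by
  rw [preKusuoka, withDensity_apply _ MeasurableSet.univ, Measure.restrict_univ]
  have h1 : ∀ α : unitInterval, ENNReal.ofReal (1 - (α : ℝ)) =
      ∫⁻ u, {x : unitInterval × ℝ | (x.1 : ℝ) ≤ x.2}.indicator 1 (α, u) ∂stdP := by
    intro α
    have : (fun u => {x : unitInterval × ℝ | (x.1 : ℝ) ≤ x.2}.indicator (1 : unitInterval × ℝ → ℝ≥0∞) (α, u)) =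
        (Ici (α : ℝ)).indicator 1 := rfl
    rw [this, lintegral_indicator_one measurableSet_Ici, ← Measure.restrict_apply_univ,
      stdP_restrict_Ici α.2.1]
    simp
  simp_rw [h1]
  rw [lintegral_lintegral_swap]
  · have h2 : ∀ᵐ u ∂stdP, ∫⁻ α, {x : unitInterval × ℝ | (x.1 : ℝ) ≤ x.2}.indicator 1 (α, u)
        ∂stieltjes σ = ENNReal.ofReal (σ u) := by
      filter_upwards [ae_mem_Ioo] with u hu
      have : (fun α => {x : unitInterval × ℝ | (x.1 : ℝ) ≤ x.2}.indicator (1 : unitInterval × ℝ → ℝ≥0∞) (α, u)) =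
        {α : unitInterval | (α : ℝ) ≤ u}.indicator 1 := rfl
      rw [this, lintegral_indicator_one (measurableSet_coe_le u),
        stieltjes_apply hσ ⟨hu.1.le, hu.2⟩]
    have hi : Integrable σ stdP := by
      rw [stdP_eq_Ico]
      exact hσ.integrable
    rw [lintegral_congr_ae h2, ← ofReal_integral_eq_lintegral_ofReal hi]
    · rw [stdP_eq_Ico, hσ.integral_eq_one, ENNReal.ofReal_one]
    · filter_upwards [ae_mem_Ioo] with u hu
      exact hσ.nonneg u ⟨hu.1.le, hu.2⟩
  · refine Measurable.aemeasurable ?_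
    exact Measurable.indicator measurable_const (measurableSet_le (by fun_prop) measurable_snd)

theorem preKusuoka_one (σ : ℝ → ℝ) : preKusuoka σ {1} = 0 := by
  rw [preKusuoka, withDensity_apply _ (measurableSet_singleton _)]
  refine (setLIntegral_congr_fun (measurableSet_singleton _) (g := fun _ => 0) ?_).trans (by simp)
  rintro α rfl
  simp

/-- Every spectral function is `𝕋 μ` for some `μ`. -/
theorem exists_spectrumOf_eq (hσ : IsSpectral σ) :
    ∃ μ : KMeasure, EqOn (spectrumOf μ) σ (Ico 0 1) := by
  refine ⟨⟨⟨preKusuoka σ, ⟨preKusuoka_univ hσ⟩⟩, preKusuoka_one σ⟩, fun τ hτ => ?_⟩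
  change ∫ α in {α : unitInterval | (α : ℝ) ≤ τ}, (1 - (α : ℝ))⁻¹ ∂preKusuoka σ = σ τ
  rw [integral_eq_lintegral_of_nonneg_ae (Eventually.of_forall fun α => inv_one_sub_nonneg α)
    (Measurable.aestronglyMeasurable (by fun_prop)), preKusuoka,
    setLIntegral_withDensity_eq_setLIntegral_mul _ measurable_ofReal_one_sub (by fun_prop)
      (measurableSet_coe_le τ)]
  -- As `τ < 1`, the densities `1 - α` and `(1 - α)⁻¹` cancel on `{α ≤ τ}`.
  have : ∫⁻ α in {α : unitInterval | (α : ℝ) ≤ τ}, ((fun α : unitInterval =>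
      ENNReal.ofReal (1 - (α : ℝ))) * fun α : unitInterval => ENNReal.ofReal (1 - (α : ℝ))⁻¹) α
      ∂stieltjes σ = ∫⁻ α in {α : unitInterval | (α : ℝ) ≤ τ}, 1 ∂stieltjes σ := by
    refine setLIntegral_congr_fun (measurableSet_coe_le τ) fun α hα => ?_
    have hα' : (α : ℝ) ≤ τ := hα
    have h : 0 < 1 - (α : ℝ) := by linarith [hτ.2]
    rw [Pi.mul_apply, ← ENNReal.ofReal_mul h.le, mul_inv_cancel₀ h.ne', ENNReal.ofReal_one]
  rw [this, setLIntegral_one, stieltjes_apply hσ hτ, ENNReal.toReal_ofReal (hσ.nonneg τ hτ)]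

end Surjectivity

/-! ### Power inequalities and norms for conjugate exponents -/

section Exponents

variable {p q : ℝ}

/-- Strict Bernoulli at `s = a / b - 1`, multiplied by `b ^ q`. This strict convexity is what makes
maximizers unique. -/
theorem tangent_lt_rpow (hq : 1 < q) {a b : ℝ} (ha : 0 ≤ a) (hb : 0 ≤ b) (hab : a ≠ b) :
    b ^ q + q * b ^ (q - 1) * (a - b) < a ^ q := by
  rcases hb.eq_or_lt with rfl | hb'
  · have ha' : 0 < a := lt_of_le_of_ne ha hab.symm
    rw [Real.zero_rpow (by linarith), Real.zero_rpow (by linarith)]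
    simpa using Real.rpow_pos_of_pos ha' q
  · have h := one_add_mul_self_lt_rpow_one_add (s := a / b - 1) (p := q)
      (by linarith [div_nonneg ha hb]) (by
        intro h
        exact hab ((div_eq_one_iff_eq hb'.ne').1 (by linarith))) hq
    have hbq : 0 < b ^ q := Real.rpow_pos_of_pos hb' q
    have h2 := mul_lt_mul_of_pos_left h hbq
    have e1 : b ^ q * (1 + (a / b - 1)) ^ q = a ^ q := by
      rw [add_sub_cancel, Real.div_rpow ha hb, mul_div_cancel₀ _ hbq.ne']
    have e2 : b ^ q * (1 + q * (a / b - 1)) = b ^ q + q * b ^ (q - 1) * (a - b) := by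
      rw [Real.rpow_sub_one hb'.ne']
      field_simp
    rwa [e1, e2] at h2

theorem tangent_le_rpow (hq : 1 < q) {a b : ℝ} (ha : 0 ≤ a) (hb : 0 ≤ b) :
    b ^ q + q * b ^ (q - 1) * (a - b) ≤ a ^ q := by
  rcases eq_or_ne a b with rfl | hab
  · simp
  · exact (tangent_lt_rpow hq ha hb hab).le

theorem rpow_sub_one_rpow (hpq : p.HolderConjugate q) {x : ℝ} (hx : 0 ≤ x) :
    (x ^ (q - 1)) ^ p = x ^ q := by
  rw [← Real.rpow_mul hx, hpq.symm.sub_one_mul_conj]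

theorem mul_rpow_sub_one (hq : 1 < q) {x : ℝ} (hx : 0 ≤ x) : x * x ^ (q - 1) = x ^ q := by
  rcases hx.eq_or_lt with rfl | hx'
  · rw [zero_mul, Real.zero_rpow (by linarith)]
  · rw [Real.rpow_sub_one hx'.ne']
    field_simp

/-- Division by `x^(1/p)`. With `x = ∫ ζ^q`, it turns the outcome of testing against `ζ^(q-1)` into
a norm bound. -/
theorem le_rpow_of_le_mul_rpow (hpq : p.HolderConjugate q) {c x : ℝ} (hc : 0 ≤ c) (hx : 0 ≤ x)
    (h : x ≤ c * x ^ (1 / p)) : x ≤ c ^ q := by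
  rcases hx.eq_or_lt with rfl | hx'
  · exact Real.rpow_nonneg hc q
  · have h1 : x ^ (1 / p) * x ^ (1 / q) = x := by
      rw [← Real.rpow_add hx', hpq.one_div_add_one_div, div_one, Real.rpow_one]
    have h2 : x ^ (1 / q) ≤ c := by
      rw [← mul_le_mul_iff_right₀ (Real.rpow_pos_of_pos hx' (1 / p)), h1, mul_comm]
      exact h
    calc x = (x ^ (1 / q)) ^ q := by
          rw [← Real.rpow_mul hx, one_div_mul_cancel hpq.symm.ne_zero, Real.rpow_one]
      _ ≤ c ^ q := Real.rpow_le_rpow (Real.rpow_nonneg hx _) h2 hpq.symm.nonneg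

variable {μ : Measure ℝ} {f : ℝ → ℝ}

theorem integrable_rpow_of_memLp (hp : 0 < p) (hf : MemLp f (ENNReal.ofReal p) μ)
    (h0 : ∀ᵐ x ∂μ, 0 ≤ f x) : Integrable (fun x => f x ^ p) μ := by
  have h := hf.integrable_norm_rpow (by simpa using hp) ENNReal.ofReal_ne_top
  rw [ENNReal.toReal_ofReal hp.le] at h
  refine h.congr ?_
  filter_upwards [h0] with x hx
  rw [Real.norm_of_nonneg hx]

theorem memLp_of_integrable_rpow (hp : 0 < p) (hf : AEStronglyMeasurable f μ)
    (h0 : ∀ᵐ x ∂μ, 0 ≤ f x) (hi : Integrable (fun x => f x ^ p) μ) :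
    MemLp f (ENNReal.ofReal p) μ := by
  rw [← integrable_norm_rpow_iff hf (by simpa using hp) ENNReal.ofReal_ne_top,
    ENNReal.toReal_ofReal hp.le]
  refine hi.congr ?_
  filter_upwards [h0] with x hx
  rw [Real.norm_of_nonneg hx]

theorem eLpNorm_eq_ofReal (hp : 0 < p) (hf : MemLp f (ENNReal.ofReal p) μ)
    (h0 : ∀ᵐ x ∂μ, 0 ≤ f x) :
    eLpNorm f (ENNReal.ofReal p) μ = ENNReal.ofReal ((∫ x, f x ^ p ∂μ) ^ (1 / p)) := by
  rw [hf.eLpNorm_eq_integral_rpow_norm (by simpa using hp) ENNReal.ofReal_ne_top,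
    ENNReal.toReal_ofReal hp.le, one_div]
  congr 2
  refine integral_congr_ae ?_
  filter_upwards [h0] with x hx
  rw [Real.norm_of_nonneg hx]

theorem eLpNorm_eq_iff (hp : 0 < p) (hf : MemLp f (ENNReal.ofReal p) μ)
    (h0 : ∀ᵐ x ∂μ, 0 ≤ f x) {c : ℝ} (hc : 0 ≤ c) :
    eLpNorm f (ENNReal.ofReal p) μ = ENNReal.ofReal c ↔ ∫ x, f x ^ p ∂μ = c ^ p := by
  have hi : 0 ≤ ∫ x, f x ^ p ∂μ := integral_nonneg_of_ae (by
    filter_upwards [h0] with x hx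
    exact Real.rpow_nonneg hx p)
  rw [eLpNorm_eq_ofReal hp hf h0, ENNReal.ofReal_eq_ofReal_iff (Real.rpow_nonneg hi _) hc,
    one_div, Real.rpow_inv_eq hi hc hp.ne']

theorem memLp_rpow_sub_one (hpq : p.HolderConjugate q) (hf : MemLp f (ENNReal.ofReal q) μ)
    (h0 : ∀ᵐ x ∂μ, 0 ≤ f x) : MemLp (fun x => f x ^ (q - 1)) (ENNReal.ofReal p) μ := by
  refine memLp_of_integrable_rpow hpq.pos
    ((hf.1.aemeasurable.pow_const _).aestronglyMeasurable) ?_ ?_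
  · filter_upwards [h0] with x hx
    exact Real.rpow_nonneg hx _
  · refine (integrable_rpow_of_memLp hpq.symm.pos hf h0).congr ?_
    filter_upwards [h0] with x hx
    rw [rpow_sub_one_rpow hpq hx]

theorem integrable_mul_of_memLp (hpq : p.HolderConjugate q) {g : ℝ → ℝ}
    (hg : MemLp g (ENNReal.ofReal q) μ) (hf : MemLp f (ENNReal.ofReal p) μ) :
    Integrable (fun x => g x * f x) μ := by
  have := hpq.ennrealOfReal
  exact MeasureTheory.MemLp.integrable_mul hg hf

end Exponents

/-! ### Hölder bounds for the risk measure -/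

section Risk

variable {p q c : ℝ} {Z W ζ : ℝ → ℝ}

theorem memLp_posPart_sub (hZ : MemLp Z (ENNReal.ofReal p) stdP) (t : ℝ) :
    MemLp (fun u => max (Z u - t) 0) (ENNReal.ofReal p) stdP :=
  (hZ.sub (memLp_const t)).pos_part

theorem posPartNorm_eq (hp : 0 < p) (hZ : MemLp Z (ENNReal.ofReal p) stdP) (t : ℝ) :
    posPartNorm (ENNReal.ofReal p) Z t = (∫ u, max (Z u - t) 0 ^ p ∂stdP) ^ (1 / p) := by
  have h0 : ∀ᵐ u ∂stdP, 0 ≤ max (Z u - t) 0 := Eventually.of_forall fun u => le_max_right _ _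
  rw [posPartNorm, eLpNorm_eq_ofReal hp (memLp_posPart_sub hZ t) h0, ENNReal.toReal_ofReal]
  exact Real.rpow_nonneg (integral_nonneg fun u => Real.rpow_nonneg (le_max_right _ _) p) _

theorem one_le_ofReal (hp : 1 < p) : 1 ≤ ENNReal.ofReal p := by
  simpa using hp.le

/-- Densities in the unit ball of radius `c` are dominated by each term of the infimum. -/
theorem integral_mul_le_term (hpq : p.HolderConjugate q) (hc : 0 ≤ c)
    (hζ : MemLp ζ (ENNReal.ofReal q) stdP) (h0 : ∀ᵐ u ∂stdP, 0 ≤ ζ u)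
    (h1 : ∫ u, ζ u ∂stdP = 1) (hn : ∫ u, ζ u ^ q ∂stdP ≤ c ^ q)
    (hZ : MemLp Z (ENNReal.ofReal p) stdP) (t : ℝ) :
    ∫ u, ζ u * Z u ∂stdP ≤ t + c * (∫ u, max (Z u - t) 0 ^ p ∂stdP) ^ (1 / p) := by
  have hζi : Integrable ζ stdP := hζ.integrable (one_le_ofReal hpq.symm.lt)
  have hY := memLp_posPart_sub hZ t
  have e : ∫ u, ζ u * Z u ∂stdP = t + ∫ u, ζ u * (Z u - t) ∂stdP := by
    simp_rw [mul_sub]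
    rw [integral_sub (integrable_mul_of_memLp hpq hζ hZ) (hζi.mul_const t), integral_mul_const, h1]
    ring
  rw [e]
  gcongr
  calc ∫ u, ζ u * (Z u - t) ∂stdP ≤ ∫ u, ζ u * max (Z u - t) 0 ∂stdP := by
        refine integral_mono_ae
          (integrable_mul_of_memLp hpq hζ (hZ.sub (memLp_const t)))
          (integrable_mul_of_memLp hpq hζ hY) ?_
        filter_upwards [h0] with u hu
        exact mul_le_mul_of_nonneg_left (le_max_left _ _) hu
    _ ≤ (∫ u, ζ u ^ q ∂stdP) ^ (1 / q) * (∫ u, max (Z u - t) 0 ^ p ∂stdP) ^ (1 / p) :=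
        integral_mul_le_Lp_mul_Lq_of_nonneg hpq.symm h0
          (Eventually.of_forall fun u => le_max_right _ _) hζ hY
    _ ≤ c * (∫ u, max (Z u - t) 0 ^ p ∂stdP) ^ (1 / p) := by
        refine mul_le_mul_of_nonneg_right ?_ (Real.rpow_nonneg
          (integral_nonneg fun u => Real.rpow_nonneg (le_max_right _ _) p) _)
        calc (∫ u, ζ u ^ q ∂stdP) ^ (1 / q) ≤ (c ^ q) ^ (1 / q) := by
              refine Real.rpow_le_rpow (integral_nonneg_of_ae ?_) hn hpq.symm.one_div_nonneg
              filter_upwards [h0] with u hu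
              exact Real.rpow_nonneg hu q
          _ = c := by
              rw [← Real.rpow_mul hc, mul_one_div_cancel hpq.symm.ne_zero, Real.rpow_one]

theorem integral_posPart_rpow_congr (h : IdentDistrib W Z stdP stdP) (t : ℝ) :
    ∫ u, max (Z u - t) 0 ^ p ∂stdP = ∫ u, max (W u - t) 0 ^ p ∂stdP :=
  (h.comp (u := fun x => max (x - t) 0 ^ p) (by fun_prop)).integral_eq.symm

/-- Each term of the infimum depends only on the law of `Z`, so `W` may be any function with that
law, for instance its quantile function. -/
theorem integral_mul_le_risk (hpq : p.HolderConjugate q) (hc : 0 ≤ c)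
    (hζ : MemLp ζ (ENNReal.ofReal q) stdP) (h0 : ∀ᵐ u ∂stdP, 0 ≤ ζ u)
    (h1 : ∫ u, ζ u ∂stdP = 1) (hn : ∫ u, ζ u ^ q ∂stdP ≤ c ^ q)
    (hW : MemLp W (ENNReal.ofReal p) stdP) (Z : Lp ℝ (ENNReal.ofReal p) stdP)
    (hZW : IdentDistrib W Z stdP stdP) :
    ∫ u, ζ u * W u ∂stdP ≤ higherOrderRisk c (ENNReal.ofReal p) Z := by
  refine le_ciInf fun t => ?_
  rw [posPartNorm_eq hpq.pos (Lp.memLp Z),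
    integral_posPart_rpow_congr hZW]
  exact integral_mul_le_term hpq hc hζ h0 h1 hn hW t

theorem risk_le (hp : 1 < p) (hc : 1 < c)
    (Z : Lp ℝ (ENNReal.ofReal p) stdP) (hZW : IdentDistrib W Z stdP stdP) (t : ℝ) :
    higherOrderRisk c (ENNReal.ofReal p) Z ≤
      t + c * (∫ u, max (W u - t) 0 ^ p ∂stdP) ^ (1 / p) := by
  refine (ciInf_le (bddBelow_higherOrderRisk c hc.le _ (one_le_ofReal hp) Z) t).trans ?_
  rw [posPartNorm_eq (by linarith) (Lp.memLp Z),
    integral_posPart_rpow_congr hZW]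

theorem identDistrib_toLp {r : ℝ≥0∞} (hW : MemLp W r stdP) :
    IdentDistrib W (hW.toLp W) stdP stdP :=
  IdentDistrib.of_ae_eq hW.1.aemeasurable hW.coeFn_toLp.symm

theorem pairing_toLp {r s : ℝ≥0∞} (ζ : Lp ℝ s stdP) (hW : MemLp W r stdP) :
    pairing ζ (hW.toLp W) = ∫ u, ζ u * W u ∂stdP := by
  refine integral_congr_ae ?_
  filter_upwards [hW.coeFn_toLp] with u hu
  rw [hu]

/-- The risk of a nonnegative random variable is at most `c` times its norm. -/
theorem risk_le_of_nonneg (hp : 1 < p) (hc : 1 < c) (hW : MemLp W (ENNReal.ofReal p) stdP)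
    (h0 : ∀ᵐ u ∂stdP, 0 ≤ W u) :
    higherOrderRisk c (ENNReal.ofReal p) (hW.toLp W) ≤
      c * (∫ u, W u ^ p ∂stdP) ^ (1 / p) := by
  refine (risk_le hp hc _ (identDistrib_toLp hW) 0).trans (le_of_eq ?_)
  rw [zero_add]
  congr 2
  refine integral_congr_ae ?_
  filter_upwards [h0] with u hu
  rw [sub_zero, max_eq_left hu]

end Risk

/-! ### The dual set and its exposed points -/

section Dual

variable {p q c : ℝ}

theorem risk_const_le (hp : 1 < p) (hc : 1 < c) (a : ℝ) :
    higherOrderRisk c (ENNReal.ofReal p) ((memLp_const a).toLp fun _ => a) ≤ a := by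
  refine (risk_le hp hc _ (identDistrib_toLp (memLp_const a)) a).trans (le_of_eq ?_)
  simp [Real.zero_rpow (show p ≠ 0 by linarith), Real.zero_rpow (show p⁻¹ ≠ 0 by positivity)]

/-- The dual set consists of the densities of norm at most `c`. -/
theorem mem_dualSet_iff (hpq : p.HolderConjugate q) (hc : 1 < c)
    (ζ : Lp ℝ (ENNReal.ofReal q) stdP) :
    ζ ∈ dualSet (ENNReal.ofReal q) (higherOrderRisk c (ENNReal.ofReal p)) ↔
      (∀ᵐ u ∂stdP, 0 ≤ ζ u) ∧ ∫ u, ζ u ∂stdP = 1 ∧ ∫ u, ζ u ^ q ∂stdP ≤ c ^ q := by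
  have hc0 : 0 ≤ c := by linarith
  have hζ := Lp.memLp ζ
  have hζi : Integrable ζ stdP := hζ.integrable (one_le_ofReal hpq.symm.lt)
  constructor
  · intro h
    have h1 : ∫ u, ζ u ∂stdP = 1 := by
      -- Constants of both signs force the integral to be `1`.
      have key : ∀ a : ℝ, (∫ u, ζ u ∂stdP) * a ≤ a := fun a => by
        have := (h ((memLp_const a).toLp fun _ => a)).trans (risk_const_le hpq.lt hc a)
        rwa [pairing_toLp, integral_mul_const] at this
      linarith [key 1, key (-1)]
    have h0 : ∀ᵐ u ∂stdP, 0 ≤ ζ u := by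
      -- The test variable equal to `-1` on `B` and `0` elsewhere has risk at most `0` (take `t =
      -- 0`), whereas its pairing with `ζ` is the integral of the negative part of `ζ`.
      set B : Set ℝ := {u | ζ u < 0} with hB
      have hBm : MeasurableSet B :=
        measurableSet_lt (Lp.stronglyMeasurable ζ).measurable measurable_const
      have hW : MemLp (B.indicator fun _ => (-1 : ℝ)) (ENNReal.ofReal p) stdP :=
        (memLp_const _).indicator hBm
      have h2 := (h (hW.toLp _)).trans (risk_le hpq.lt hc _ (identDistrib_toLp hW) 0)
      have e1 : ∀ u, max (B.indicator (fun _ => (-1 : ℝ)) u - 0) 0 = 0 := by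
        intro u
        by_cases hu : u ∈ B <;> simp [hu]
      simp only [e1] at h2
      have e2 : ∀ u, ζ u * B.indicator (fun _ => (-1 : ℝ)) u = max (-ζ u) 0 := by
        intro u
        by_cases hu : u ∈ B
        · have hu' : ζ u < 0 := hu
          rw [indicator_of_mem hu, max_eq_left (by linarith)]
          ring
        · have hu' : ¬ ζ u < 0 := hu
          rw [indicator_of_notMem hu, max_eq_right (by linarith), mul_zero]
      rw [pairing_toLp] at h2
      simp only [e2] at h2
      have h3 : ∫ u, max (-ζ u) 0 ∂stdP = 0 := by
        refine le_antisymm (h2.trans (le_of_eq ?_)) (integral_nonneg fun u => le_max_right _ _)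
        simp [Real.zero_rpow hpq.ne_zero, Real.zero_rpow (inv_ne_zero hpq.ne_zero)]
      have hi : Integrable (fun u => max (-ζ u) 0) stdP := hζi.neg.pos_part
      have h4 := (integral_eq_zero_iff_of_nonneg (fun u => le_max_right _ _) hi).1 h3
      filter_upwards [h4] with u hu
      have hu' : max (-ζ u) 0 = 0 := hu
      linarith [le_max_left (-ζ u) 0]
    refine ⟨h0, h1, ?_⟩
    -- Testing with `ζ^(q-1)` gives `∫ ζ^q ≤ c (∫ ζ^q)^(1/p)`.
    have hW := memLp_rpow_sub_one hpq hζ h0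
    have hW0 : ∀ᵐ u ∂stdP, 0 ≤ ζ u ^ (q - 1) := by
      filter_upwards [h0] with u hu
      exact Real.rpow_nonneg hu _
    have h2 := (h (hW.toLp _)).trans (risk_le_of_nonneg hpq.lt hc hW hW0)
    have e1 : ∫ u, ζ u * ζ u ^ (q - 1) ∂stdP = ∫ u, ζ u ^ q ∂stdP := by
      refine integral_congr_ae ?_
      filter_upwards [h0] with u hu
      rw [mul_rpow_sub_one hpq.symm.lt hu]
    have e2 : ∫ u, (ζ u ^ (q - 1)) ^ p ∂stdP = ∫ u, ζ u ^ q ∂stdP := by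
      refine integral_congr_ae ?_
      filter_upwards [h0] with u hu
      rw [rpow_sub_one_rpow hpq hu]
    rw [pairing_toLp, e1, e2] at h2
    refine le_rpow_of_le_mul_rpow hpq hc0 (integral_nonneg_of_ae ?_) h2
    filter_upwards [h0] with u hu
    exact Real.rpow_nonneg hu _
  · rintro ⟨h0, h1, hn⟩ Z
    exact integral_mul_le_risk hpq hc0 hζ h0 h1 hn (Lp.memLp Z) Z
      (IdentDistrib.refl (Lp.memLp Z).1.aemeasurable)

/-- The tangent inequality, integrated: `ζ ^ (q - 1)` exposes `ζ`. -/
theorem integral_mul_rpow_lt (hpq : p.HolderConjugate q) {ζ η : ℝ → ℝ}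
    (hζ : MemLp ζ (ENNReal.ofReal q) stdP) (hη : MemLp η (ENNReal.ofReal q) stdP)
    (h0 : ∀ᵐ u ∂stdP, 0 ≤ ζ u) (h0' : ∀ᵐ u ∂stdP, 0 ≤ η u)
    (hle : ∫ u, η u ^ q ∂stdP ≤ ∫ u, ζ u ^ q ∂stdP) (hne : ¬ η =ᵐ[stdP] ζ) :
    ∫ u, η u * ζ u ^ (q - 1) ∂stdP < ∫ u, ζ u * ζ u ^ (q - 1) ∂stdP := by
  have hW := memLp_rpow_sub_one hpq hζ h0
  have i1 := integrable_rpow_of_memLp hpq.symm.pos hη h0'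
  have i2 := integrable_rpow_of_memLp hpq.symm.pos hζ h0
  have i3 := integrable_mul_of_memLp hpq hη hW
  have i4 := integrable_mul_of_memLp hpq hζ hW
  by_contra! hge
  -- `D` is the gap in the tangent inequality at `ζ`, hence nonnegative. If the claim failed its
  -- integral would be at most `0`, so `D = 0` almost everywhere, and strictness would give `η = ζ`.
  let D : ℝ → ℝ := fun u =>
    (η u ^ q - ζ u ^ q) - q * (η u * ζ u ^ (q - 1) - ζ u * ζ u ^ (q - 1))
  have i12 : Integrable (fun u => η u ^ q - ζ u ^ q) stdP := i1.sub i2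
  have i34 : Integrable (fun u => η u * ζ u ^ (q - 1) - ζ u * ζ u ^ (q - 1)) stdP := i3.sub i4
  have hD : Integrable D stdP := i12.sub (i34.const_mul q)
  have hDint : ∫ u, D u ∂stdP = (∫ u, η u ^ q ∂stdP - ∫ u, ζ u ^ q ∂stdP) -
      q * (∫ u, η u * ζ u ^ (q - 1) ∂stdP - ∫ u, ζ u * ζ u ^ (q - 1) ∂stdP) := by
    simp only [D]
    rw [integral_sub i12 (i34.const_mul q), integral_const_mul,
      integral_sub i1 i2, integral_sub i3 i4]
  have hDeq : ∀ u, D u = η u ^ q - (ζ u ^ q + q * ζ u ^ (q - 1) * (η u - ζ u)) := fun u => by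
    simp only [D]
    ring
  have hD0 : 0 ≤ᵐ[stdP] D := by
    filter_upwards [h0, h0'] with u hu hu'
    have := tangent_le_rpow hpq.symm.lt hu' hu
    rw [Pi.zero_apply, hDeq]
    linarith
  have hDle : ∫ u, D u ∂stdP ≤ 0 := by
    rw [hDint]
    have := mul_nonneg hpq.symm.nonneg (sub_nonneg.2 hge)
    linarith
  have h := (integral_eq_zero_iff_of_nonneg_ae hD0 hD).1
    (le_antisymm hDle (integral_nonneg_of_ae hD0))
  refine hne ?_
  filter_upwards [h, h0, h0'] with u hu hu0 hu0'
  by_contra hne'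
  have := tangent_lt_rpow hpq.symm.lt hu0' hu0 hne'
  rw [hDeq, Pi.zero_apply] at hu
  linarith

/-- A density of norm less than `c` can be perturbed in two opposite directions. -/
theorem exists_perturbation (hpq : p.HolderConjugate q)
    (ζ : Lp ℝ (ENNReal.ofReal q) stdP) (h0 : ∀ᵐ u ∂stdP, 0 ≤ ζ u)
    (h1 : ∫ u, ζ u ∂stdP = 1) (hn : ∫ u, ζ u ^ q ∂stdP < c ^ q) :
    ∃ h : Lp ℝ (ENNReal.ofReal q) stdP, h ≠ 0 ∧
      ∀ s : ℝ, s = 1 ∨ s = -1 → (∀ᵐ u ∂stdP, 0 ≤ ζ u + s * h u) ∧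
        ∫ u, (ζ u + s * h u) ∂stdP = 1 ∧ ∫ u, (ζ u + s * h u) ^ q ∂stdP ≤ c ^ q := by
  have hζ := Lp.memLp ζ
  have hζi : Integrable ζ stdP := hζ.integrable (one_le_ofReal hpq.symm.lt)
  have hζm := (Lp.stronglyMeasurable ζ).measurable
  -- A density of mean `1` exceeds `1/2` on a set of positive measure; there a perturbation of size
  -- below `1/2` preserves the sign.
  set B : Set ℝ := {u | 1 / 2 < ζ u} with hB
  have hBm : MeasurableSet B := measurableSet_lt measurable_const hζm
  have hBpos : stdP B ≠ 0 := by
    intro hB0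
    have : ∀ᵐ u ∂stdP, ζ u ≤ 1 / 2 := by
      rw [ae_iff]
      simpa [hB] using hB0
    have := integral_mono_ae hζi (integrable_const (1 / 2 : ℝ)) this
    rw [h1] at this
    simp at this
    norm_num at this
  have hBr : stdP.real B ≠ 0 := (measureReal_ne_zero_iff (measure_ne_top _ _)).2 hBpos
  have hBr0 : 0 < stdP.real B := lt_of_le_of_ne measureReal_nonneg hBr.symm
  have hid : Integrable (fun u : ℝ => u) stdP := by
    refine Integrable.of_bound (C := 1) measurable_id.aestronglyMeasurable ?_
    filter_upwards [ae_mem_Ioo] with u hu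
    rw [Real.norm_of_nonneg hu.1.le]
    exact hu.2.le
  -- `m` is the mean of `u` over `B`. Then `u - m` on `B` integrates to zero but vanishes at one
  -- point only, so `g` is a nonzero bounded direction.
  set m : ℝ := (∫ u in B, u ∂stdP) / stdP.real B with hm
  let g : ℝ → ℝ := B.indicator fun u => u - m
  have hgm : Measurable g := Measurable.indicator (by fun_prop) hBm
  have hm0 : 0 ≤ m := div_nonneg (setIntegral_nonneg_of_ae (by
    filter_upwards [ae_mem_Ioo] with u hu
    exact hu.1.le)) hBr0.le
  have hm1 : m ≤ 1 := by
    rw [hm, div_le_one hBr0]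
    calc ∫ u in B, u ∂stdP ≤ ∫ u in B, (1 : ℝ) ∂stdP := by
          refine setIntegral_mono_ae hid.integrableOn (integrable_const _).integrableOn ?_
          filter_upwards [ae_mem_Ioo] with u hu
          exact hu.2.le
      _ = stdP.real B := by simp
  have hgb : ∀ᵐ u ∂stdP, |g u| ≤ 1 := by
    filter_upwards [ae_mem_Ioo] with u hu
    by_cases huB : u ∈ B
    · simp only [g, indicator_of_mem huB]
      rw [abs_le]
      constructor <;> linarith [hu.1, hu.2]
    · simp [g, indicator_of_notMem huB]
  have hgi : Integrable g stdP := Integrable.of_bound (C := 1) hgm.aestronglyMeasurable hgb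
  have hg0 : ∫ u, g u ∂stdP = 0 := by
    simp only [g]
    rw [integral_indicator hBm, integral_sub hid.integrableOn (integrable_const _)]
    simp only [integral_const, MeasurableSet.univ, measureReal_restrict_apply, univ_inter,
      smul_eq_mul]
    rw [hm]
    field_simp
    ring
  have hgne : ¬ g =ᵐ[stdP] 0 := by
    intro h
    refine hBpos (measure_mono_null (t := {u | ¬ (g u = 0 ∧ u ≠ m)}) ?_
      (ae_iff.1 (h.and (ae_ne m))))
    intro u hu
    rintro ⟨h1, h2⟩
    simp only [g, indicator_of_mem hu] at h1
    exact h2 (by linarith)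
  -- The truncation at `0` keeps the powers controlled for every `s`; it is inactive for the
  -- perturbations finally used.
  have hcont : ContinuousAt (fun s : ℝ => ∫ u, max (ζ u + s * g u) 0 ^ q ∂stdP) 0 := by
    have hq := hpq.symm.pos
    refine continuousAt_of_dominated (bound := fun u => (ζ u + 1) ^ q) ?_ ?_ ?_ ?_
    · exact Eventually.of_forall fun s => Measurable.aestronglyMeasurable (by fun_prop)
    · filter_upwards [Metric.ball_mem_nhds (0 : ℝ) one_pos] with s hs
      have hs' : |s| < 1 := by simpa using hs
      filter_upwards [h0, hgb] with u hu hgu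
      rw [Real.norm_of_nonneg (Real.rpow_nonneg (le_max_right _ _) _)]
      refine Real.rpow_le_rpow (le_max_right _ _) (max_le ?_ (by linarith)) hq.le
      have : s * g u ≤ 1 := by
        calc s * g u ≤ |s * g u| := le_abs_self _
          _ = |s| * |g u| := abs_mul _ _
          _ ≤ 1 * 1 := by gcongr
          _ = 1 := one_mul 1
      linarith
    · refine integrable_rpow_of_memLp hq (hζ.add (memLp_const 1)) ?_
      filter_upwards [h0] with u hu
      linarith
    · refine Eventually.of_forall fun u => ?_
      refine ContinuousAt.rpow_const (by fun_prop) (Or.inr hq.le)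
  have hval : ∫ u, max (ζ u + 0 * g u) 0 ^ q ∂stdP < c ^ q := by
    refine lt_of_eq_of_lt (integral_congr_ae ?_) hn
    filter_upwards [h0] with u hu
    rw [zero_mul, add_zero, max_eq_left hu]
  obtain ⟨δ, hδ, hball⟩ := Metric.eventually_nhds_iff.1 (hcont.eventually (gt_mem_nhds hval))
  obtain ⟨r, hr0, hr⟩ := exists_between (lt_min hδ (show (0 : ℝ) < 1 / 2 by norm_num))
  have hrg : MemLp (fun u => r * g u) (ENNReal.ofReal q) stdP :=
    MemLp.of_bound (hgm.const_mul r).aestronglyMeasurable r (by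
      filter_upwards [hgb] with u hu
      rw [norm_mul, Real.norm_of_nonneg hr0.le, Real.norm_eq_abs]
      exact mul_le_of_le_one_right hr0.le hu)
  refine ⟨hrg.toLp _, ?_, fun s hs => ?_⟩
  · intro h
    refine hgne ?_
    have h2 := hrg.coeFn_toLp
    rw [h] at h2
    filter_upwards [h2, Lp.coeFn_zero ℝ (ENNReal.ofReal q) stdP] with u hu hu'
    rw [hu'] at hu
    have : r * g u = 0 := hu.symm
    simpa [hr0.ne'] using this
  · have hs1 : |s| = 1 := by rcases hs with rfl | rfl <;> simp
    have hnn : ∀ᵐ u ∂stdP, 0 ≤ ζ u + s * (r * g u) := by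
      filter_upwards [h0, hgb] with u hu hgu
      have hb : |s * (r * g u)| ≤ r := by
        rw [abs_mul, hs1, one_mul, abs_mul, abs_of_pos hr0]
        exact mul_le_of_le_one_right hr0.le hgu
      by_cases huB : u ∈ B
      · have huB' : 1 / 2 < ζ u := huB
        have := (abs_le.1 hb).1
        have := hr.trans_le (min_le_right _ _)
        linarith
      · simpa [g, indicator_of_notMem huB] using hu
    refine ⟨?_, ?_, ?_⟩
    · filter_upwards [hnn, hrg.coeFn_toLp] with u hu hu'
      rwa [hu']
    · have : ∫ u, (ζ u + s * (hrg.toLp _ : Lp ℝ (ENNReal.ofReal q) stdP) u) ∂stdP =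
          ∫ u, (ζ u + s * (r * g u)) ∂stdP := by
        refine integral_congr_ae ?_
        filter_upwards [hrg.coeFn_toLp] with u hu
        rw [hu]
      rw [this, integral_add hζi ((hgi.const_mul r).const_mul s), integral_const_mul,
        integral_const_mul, hg0, h1]
      ring
    · have hd : dist (s * r) 0 < δ := by
        rw [Real.dist_eq, sub_zero, abs_mul, hs1, one_mul, abs_of_pos hr0]
        exact hr.trans_le (min_le_left _ _)
      refine le_trans (le_of_eq (integral_congr_ae ?_)) (hball hd).le
      filter_upwards [hnn, hrg.coeFn_toLp] with u hu hu'
      rw [hu', ← mul_assoc] at *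
      rw [max_eq_left hu]

theorem pairing_add_smul (hpq : p.HolderConjugate q) (ζ h : Lp ℝ (ENNReal.ofReal q) stdP)
    (Z : Lp ℝ (ENNReal.ofReal p) stdP) (s : ℝ) :
    pairing (ζ + s • h) Z = pairing ζ Z + s * pairing h Z := by
  have i1 := integrable_mul_of_memLp hpq (Lp.memLp ζ) (Lp.memLp Z)
  have i2 := integrable_mul_of_memLp hpq (Lp.memLp h) (Lp.memLp Z)
  unfold pairing
  rw [← integral_const_mul, ← integral_add i1 (i2.const_mul s)]
  refine integral_congr_ae ?_
  filter_upwards [Lp.coeFn_add ζ (s • h), Lp.coeFn_smul s h] with u hu hu'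
  rw [hu, Pi.add_apply, hu', Pi.smul_apply, smul_eq_mul]
  ring

/-- The exposed points of the dual set are the densities of norm `c`. -/
theorem mem_weakStarExposed_iff (hpq : p.HolderConjugate q) (hc : 1 < c)
    (ζ : Lp ℝ (ENNReal.ofReal q) stdP) :
    ζ ∈ weakStarExposed (ENNReal.ofReal p)
        (dualSet (ENNReal.ofReal q) (higherOrderRisk c (ENNReal.ofReal p))) ↔
      (∀ᵐ u ∂stdP, 0 ≤ ζ u) ∧ ∫ u, ζ u ∂stdP = 1 ∧ ∫ u, ζ u ^ q ∂stdP = c ^ q := by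
  constructor
  · rintro ⟨hζ, Z, hZ⟩
    obtain ⟨h0, h1, hn⟩ := (mem_dualSet_iff hpq hc ζ).1 hζ
    refine ⟨h0, h1, ?_⟩
    by_contra hne
    obtain ⟨h, hh, hs⟩ := exists_perturbation hpq ζ h0 h1 (lt_of_le_of_ne hn hne)
    -- A unique maximizer would strictly beat both `ζ + h` and `ζ - h`, so the pairing of `h` with
    -- `Z` would be both negative and positive.
    have key : ∀ s : ℝ, s = 1 ∨ s = -1 → s * pairing h Z < 0 := by
      intro s hs1
      obtain ⟨a0, a1, a2⟩ := hs s hs1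
      have hs0 : s ≠ 0 := by rcases hs1 with rfl | rfl <;> norm_num
      have hcoe : ∀ᵐ u ∂stdP, (ζ + s • h : Lp ℝ (ENNReal.ofReal q) stdP) u = ζ u + s * h u := by
        filter_upwards [Lp.coeFn_add ζ (s • h), Lp.coeFn_smul s h] with u hu hu'
        rw [hu, Pi.add_apply, hu', Pi.smul_apply, smul_eq_mul]
      have hmem : ζ + s • h ∈ dualSet (ENNReal.ofReal q)
          (higherOrderRisk c (ENNReal.ofReal p)) := by
        rw [mem_dualSet_iff hpq hc]
        refine ⟨?_, ?_, ?_⟩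
        · filter_upwards [hcoe, a0] with u hu hu'
          rwa [hu]
        · rw [integral_congr_ae hcoe, a1]
        · refine le_trans (le_of_eq (integral_congr_ae ?_)) a2
          filter_upwards [hcoe] with u hu
          rw [hu]
      have := hZ _ hmem (by
        intro h'
        simp [hs0, hh] at h')
      rw [pairing_add_smul hpq] at this
      linarith
    linarith [key 1 (Or.inl rfl), key (-1) (Or.inr rfl)]
  · rintro ⟨h0, h1, hn⟩
    have hW := memLp_rpow_sub_one hpq (Lp.memLp ζ) h0
    refine ⟨(mem_dualSet_iff hpq hc ζ).2 ⟨h0, h1, hn.le⟩, hW.toLp _, fun η hη hne => ?_⟩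
    obtain ⟨a0, a1, a2⟩ := (mem_dualSet_iff hpq hc η).1 hη
    rw [pairing_toLp, pairing_toLp]
    exact integral_mul_rpow_lt hpq (Lp.memLp ζ) (Lp.memLp η) h0 a0 (by rw [hn]; exact a2)
      fun h => hne (Lp.ext h)

end Dual

/-! ### Spectral functions as densities -/

section Spectral

variable {σ : ℝ → ℝ}

theorem IsSpectral.aemeasurable (h : IsSpectral σ) : AEMeasurable σ stdP :=
  aemeasurable_of_monotoneOn (h.mono.mono Ioo_subset_Ico_self)

theorem IsSpectral.ae_nonneg (h : IsSpectral σ) : ∀ᵐ u ∂stdP, 0 ≤ σ u := by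
  filter_upwards [ae_mem_Ioo] with u hu
  exact h.nonneg u ⟨hu.1.le, hu.2⟩

theorem IsSpectral.integral_stdP (h : IsSpectral σ) : ∫ u, σ u ∂stdP = 1 := by
  rw [stdP_eq_Ico, h.integral_eq_one]

theorem spectralRisk_eq (σ Z : ℝ → ℝ) : spectralRisk σ Z = ∫ u, σ u * quantile Z u ∂stdP := by
  rw [spectralRisk, stdP_eq_Ioo]

theorem mem_spectralSphere_iff {q c : ℝ} (hq : 0 < q) (hc : 0 ≤ c) :
    σ ∈ spectralSphere c (ENNReal.ofReal q) ↔
      IsSpectral σ ∧ MemLp σ (ENNReal.ofReal q) stdP ∧ ∫ u, σ u ^ q ∂stdP = c ^ q := by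
  constructor
  · rintro ⟨h, hn⟩
    have hm : MemLp σ (ENNReal.ofReal q) stdP :=
      ⟨h.aemeasurable.aestronglyMeasurable, by rw [hn]; exact ENNReal.ofReal_lt_top⟩
    exact ⟨h, hm, (eLpNorm_eq_iff hq hm h.ae_nonneg hc).1 hn⟩
  · rintro ⟨h, hm, hn⟩
    exact ⟨h, (eLpNorm_eq_iff hq hm h.ae_nonneg hc).2 hn⟩

end Spectral

/-! ### Attainment of the risk by a spectral function -/

section Attainment

variable {p q c r : ℝ} {Q : ℝ → ℝ}

theorem integrable_abs_add_rpow (hr : 0 < r) (hQ : MemLp Q (ENNReal.ofReal r) stdP) {a : ℝ}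
    (ha : 0 ≤ a) : Integrable (fun u => (|Q u| + a) ^ r) stdP :=
  integrable_rpow_of_memLp hr (hQ.abs.add (memLp_const a))
    (Eventually.of_forall fun u => add_nonneg (abs_nonneg (Q u)) ha)

theorem aestronglyMeasurable_posPart_rpow (hQ : AEMeasurable Q stdP) (t : ℝ) :
    AEStronglyMeasurable (fun u => max (Q u - t) 0 ^ r) stdP :=
  (((hQ.sub_const t).max aemeasurable_const).pow_const r).aestronglyMeasurable

/-- Dominated convergence near `t₀`. It is needed for `r = p` and for `r = p - 1`, which may be
smaller than `1`. -/
theorem continuous_integral_posPart_rpow (hr : 0 < r) (hQ : MemLp Q (ENNReal.ofReal r) stdP) :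
    Continuous fun t : ℝ => ∫ u, max (Q u - t) 0 ^ r ∂stdP := by
  rw [continuous_iff_continuousAt]
  intro t₀
  refine continuousAt_of_dominated (bound := fun u => (|Q u| + (|t₀| + 1)) ^ r) ?_ ?_
    (integrable_abs_add_rpow hr hQ (by positivity)) ?_
  · exact Eventually.of_forall fun t => aestronglyMeasurable_posPart_rpow hQ.1.aemeasurable t
  · filter_upwards [Metric.ball_mem_nhds t₀ one_pos] with t ht
    have ht' : |t - t₀| < 1 := by simpa [Real.dist_eq] using ht
    refine Eventually.of_forall fun u => ?_
    rw [Real.norm_of_nonneg (Real.rpow_nonneg (le_max_right _ _) _)]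
    refine Real.rpow_le_rpow (le_max_right _ _) (max_le ?_ (by positivity)) hr.le
    have h1 := (abs_lt.1 ht').1
    have h2 := neg_abs_le t₀
    have h3 := le_abs_self (Q u)
    linarith
  · refine Eventually.of_forall fun u => ?_
    exact ContinuousAt.rpow_const (by fun_prop) (Or.inr hr.le)

/-- The asymptotics of the moments at `t = -n`: `(Q + n)₊ / n` tends to `1` pointwise and is
dominated by `|Q| + 1`. -/
theorem tendsto_integral_posPart_div_rpow (hr : 0 < r) (hQ : MemLp Q (ENNReal.ofReal r) stdP) :
    Tendsto (fun n : ℕ => ∫ u, (max (Q u - -(n : ℝ)) 0 / n) ^ r ∂stdP) atTop (𝓝 1) := by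
  have h1 : ∫ _, (1 : ℝ) ∂stdP = 1 := by simp
  rw [← h1]
  refine tendsto_integral_filter_of_dominated_convergence (fun u => (|Q u| + 1) ^ r) ?_ ?_
    (integrable_abs_add_rpow hr hQ zero_le_one) ?_
  · refine Eventually.of_forall fun n => ?_
    exact ((((hQ.1.aemeasurable.sub_const _).max aemeasurable_const).div_const
      _).pow_const r).aestronglyMeasurable
  · filter_upwards [eventually_ge_atTop 1] with n hn
    have hn' : (1 : ℝ) ≤ n := by exact_mod_cast hn
    refine Eventually.of_forall fun u => ?_
    have h0 : 0 ≤ max (Q u - -(n : ℝ)) 0 / n := div_nonneg (le_max_right _ _) (by linarith)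
    rw [Real.norm_of_nonneg (Real.rpow_nonneg h0 _)]
    refine Real.rpow_le_rpow h0 ?_ hr.le
    rw [div_le_iff₀ (by linarith)]
    have h2 := abs_nonneg (Q u)
    have h3 := le_abs_self (Q u)
    refine max_le ?_ (by positivity)
    nlinarith
  · refine Eventually.of_forall fun u => ?_
    have h2 : Tendsto (fun n : ℕ => (max (Q u - -(n : ℝ)) 0 / n)) atTop (𝓝 1) := by
      have h3 : Tendsto (fun n : ℕ => Q u / n + 1) atTop (𝓝 1) := by
        simpa using (tendsto_const_div_atTop_nhds_zero_nat (Q u)).add_const 1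
      refine h3.congr' ?_
      obtain ⟨N, hN⟩ := exists_nat_gt (-Q u)
      filter_upwards [eventually_ge_atTop N, eventually_ge_atTop 1] with n hn hn1
      have hn' : (N : ℝ) ≤ n := by exact_mod_cast hn
      have hn1' : (1 : ℝ) ≤ n := by exact_mod_cast hn1
      rw [max_eq_left (by linarith)]
      field_simp
      ring
    simpa using h2.rpow_const (Or.inr hr.le)

theorem memLp_sub_one (hQ : MemLp Q (ENNReal.ofReal p) stdP) :
    MemLp Q (ENNReal.ofReal (p - 1)) stdP :=
  hQ.mono_exponent (ENNReal.ofReal_le_ofReal (by linarith))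

/-- Far to the left the density `(Q - t)₊ ^ (p - 1)`, normalized, has norm less than `c`. -/
theorem exists_le_integral_lt (hpq : p.HolderConjugate q) (hc : 1 < c)
    (hQ : MemLp Q (ENNReal.ofReal p) stdP) (T : ℝ) :
    ∃ t ≤ T, ∫ u, max (Q u - t) 0 ^ p ∂stdP <
      (c * ∫ u, max (Q u - t) 0 ^ (p - 1) ∂stdP) ^ q := by
  have hc0 : 0 < c := by linarith
  have h1 := tendsto_integral_posPart_div_rpow hpq.pos hQ
  have h2 := tendsto_integral_posPart_div_rpow hpq.sub_one_pos (memLp_sub_one hQ)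
  have h3 := (h2.const_mul c).rpow_const (p := q) (Or.inr hpq.symm.nonneg)
  rw [mul_one] at h3
  have hlt : (1 : ℝ) < c ^ q := Real.one_lt_rpow hc hpq.symm.pos
  obtain ⟨N, hN⟩ := exists_nat_gt (-T)
  obtain ⟨n, hn, hnN, hn1⟩ := ((h1.eventually_lt h3 hlt).and
    ((eventually_ge_atTop N).and (eventually_ge_atTop 1))).exists
  have hn0 : (0 : ℝ) < n := by exact_mod_cast hn1
  have hnN' : (N : ℝ) ≤ n := by exact_mod_cast hnN
  refine ⟨-(n : ℝ), by linarith, ?_⟩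
  have e : ∀ r : ℝ, ∫ u, (max (Q u - -(n : ℝ)) 0 / n) ^ r ∂stdP =
      (∫ u, max (Q u - -(n : ℝ)) 0 ^ r ∂stdP) / (n : ℝ) ^ r := by
    intro r
    rw [← integral_div]
    refine integral_congr_ae (Eventually.of_forall fun u => ?_)
    exact Real.div_rpow (le_max_right _ _) hn0.le r
  -- Since `(p - 1) q = p`, both sides carry the same factor `n ^ p`; the rescaled sides tend to `1`
  -- and to `c ^ q > 1`.
  rw [e, e, ← mul_div_assoc, Real.div_rpow
    (mul_nonneg hc0.le (integral_nonneg fun u => Real.rpow_nonneg (le_max_right _ _) _))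
    (Real.rpow_nonneg hn0.le _), ← Real.rpow_mul hn0.le, hpq.sub_one_mul_conj,
    div_lt_div_iff_of_pos_right (Real.rpow_pos_of_pos hn0 p)] at hn
  exact hn

/-- The normalized indicator of an upper tail as a spectral function. -/
theorem tail_mem_spectralSphere (hpq : p.HolderConjugate q) (hc : 1 < c) :
    ((Ici (1 - c ^ (-p))).indicator fun _ => c ^ p) ∈
      spectralSphere c (ENNReal.ofReal q) := by
  have hc0 : 0 < c := by linarith
  have hcp : 0 < c ^ p := Real.rpow_pos_of_pos hc0 p
  have hb1 : c ^ (-p) < 1 := Real.rpow_lt_one_of_one_lt_of_neg hc (by linarith [hpq.pos])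
  have hb0 : 0 < c ^ (-p) := Real.rpow_pos_of_pos hc0 _
  -- Height `c^p` over length `c^(-p)` gives integral `1` and `q`-th moment `c^(pq - p) = c^q`.
  have hint : ∀ x : ℝ, ∫ u, (Ici (1 - c ^ (-p))).indicator (fun _ => x) u ∂stdP =
      c ^ (-p) * x := by
    intro x
    rw [integral_indicator measurableSet_Ici, stdP_restrict_Ici (by linarith)]
    simp [hb0.le]
  have hmeas : Measurable ((Ici (1 - c ^ (-p))).indicator fun _ => c ^ p) :=
    measurable_const.indicator measurableSet_Ici
  have hmem : ∀ r : ℝ≥0∞, MemLp ((Ici (1 - c ^ (-p))).indicator fun _ => c ^ p) r stdP :=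
    fun r => (memLp_const _).indicator measurableSet_Ici
  rw [mem_spectralSphere_iff hpq.symm.pos hc0.le]
  refine ⟨⟨fun u _ => indicator_nonneg (fun _ _ => hcp.le) u, ?_, ?_, ?_, ?_⟩, hmem _, ?_⟩
  · intro u _ v _ huv
    by_cases hu : 1 - c ^ (-p) ≤ u
    · rw [indicator_of_mem (show u ∈ Ici _ from hu),
        indicator_of_mem (show v ∈ Ici _ from hu.trans huv)]
    · rw [indicator_of_notMem (show u ∉ Ici _ from hu)]
      exact indicator_nonneg (fun _ _ => hcp.le) v
  · intro u _
    refine tendsto_const_nhds.congr' ?_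
    by_cases hu : 1 - c ^ (-p) ≤ u
    · filter_upwards [self_mem_nhdsWithin] with v hv
      have huv : u ≤ v := hv
      rw [indicator_of_mem (show u ∈ Ici _ from hu),
        indicator_of_mem (show v ∈ Ici _ from hu.trans huv)]
    · filter_upwards [mem_nhdsWithin_of_mem_nhds (Iio_mem_nhds (not_le.1 hu))] with v hv
      have hv' : v < 1 - c ^ (-p) := hv
      rw [indicator_of_notMem (show u ∉ Ici _ from hu),
        indicator_of_notMem (show v ∉ Ici _ from not_le.2 hv')]
  · rw [IntegrableOn, ← stdP_eq_Ico]
    exact (hmem 1).integrable le_rfl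
  · rw [← stdP_eq_Ico, hint, ← Real.rpow_add hc0]
    simp
  · have : ∀ u, (Ici (1 - c ^ (-p))).indicator (fun _ => c ^ p) u ^ q =
        (Ici (1 - c ^ (-p))).indicator (fun _ => (c ^ p) ^ q) u := by
      intro u
      by_cases hu : u ∈ Ici (1 - c ^ (-p))
      · simp only [indicator_of_mem hu]
      · simp only [indicator_of_notMem hu, Real.zero_rpow hpq.symm.ne_zero]
    simp_rw [this]
    rw [hint, ← Real.rpow_mul hc0.le, ← Real.rpow_add hc0]
    congr 1
    have := hpq.sub_one_mul_conj
    have := hpq.symm.sub_one_mul_conj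
    linarith

/-- Hölder's inequality on the support of `(Q - t)₊`. -/
theorem integral_le_of_tail (hpq : p.HolderConjugate q) (hc : 1 < c)
    (hQ : MemLp Q (ENNReal.ofReal p) stdP) {t : ℝ}
    (ht : ∀ᵐ u ∂stdP, u < 1 - c ^ (-p) → Q u ≤ t) :
    (c * ∫ u, max (Q u - t) 0 ^ (p - 1) ∂stdP) ^ q ≤ ∫ u, max (Q u - t) 0 ^ p ∂stdP := by
  have hc0 : 0 < c := by linarith
  have hb1 : c ^ (-p) < 1 := Real.rpow_lt_one_of_one_lt_of_neg hc (by linarith [hpq.pos])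
  have hb0 : 0 < c ^ (-p) := Real.rpow_pos_of_pos hc0 _
  set A := ∫ u, max (Q u - t) 0 ^ p ∂stdP with hA
  have hA0 : 0 ≤ A := integral_nonneg fun u => Real.rpow_nonneg (le_max_right _ _) _
  have hY := memLp_posPart_sub hQ t
  have hY0 : ∀ᵐ u ∂stdP, 0 ≤ max (Q u - t) 0 := Eventually.of_forall fun u => le_max_right _ _
  -- The tail indicator has `L_p` norm `c⁻¹`, while `(Q-t)₊^(p-1)` has `L_q` norm `A^(1/q)`.
  have h := integral_mul_le_Lp_mul_Lq_of_nonneg (μ := stdP) hpq.symm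
    (f := fun u => max (Q u - t) 0 ^ (p - 1))
    (g := (Ici (1 - c ^ (-p))).indicator fun _ => (1 : ℝ))
    (Eventually.of_forall fun u => Real.rpow_nonneg (le_max_right _ _) _)
    (Eventually.of_forall fun u => indicator_nonneg (fun _ _ => zero_le_one) u)
    (memLp_rpow_sub_one hpq.symm hY hY0)
    ((memLp_const _).indicator measurableSet_Ici)
  have e1 : ∫ u, max (Q u - t) 0 ^ (p - 1) *
      (Ici (1 - c ^ (-p))).indicator (fun _ => (1 : ℝ)) u ∂stdP =
      ∫ u, max (Q u - t) 0 ^ (p - 1) ∂stdP := by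
    refine integral_congr_ae ?_
    filter_upwards [ht] with u hu
    by_cases h : 1 - c ^ (-p) ≤ u
    · rw [indicator_of_mem (show u ∈ Ici _ from h), mul_one]
    · rw [max_eq_right (by linarith [hu (not_le.1 h)]), Real.zero_rpow hpq.sub_one_ne_zero,
        zero_mul]
  have e2 : ∫ u, (max (Q u - t) 0 ^ (p - 1)) ^ q ∂stdP = A := by
    refine integral_congr_ae (Eventually.of_forall fun u => ?_)
    exact rpow_sub_one_rpow hpq.symm (le_max_right _ _)
  have e3 : ∫ u, (Ici (1 - c ^ (-p))).indicator (fun _ => (1 : ℝ)) u ^ p ∂stdP = c ^ (-p) := by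
    have : ∀ u, (Ici (1 - c ^ (-p))).indicator (fun _ => (1 : ℝ)) u ^ p =
        (Ici (1 - c ^ (-p))).indicator (fun _ => (1 : ℝ)) u := by
      intro u
      by_cases hu : u ∈ Ici (1 - c ^ (-p))
      · simp only [indicator_of_mem hu, Real.one_rpow]
      · simp only [indicator_of_notMem hu, Real.zero_rpow hpq.ne_zero]
    simp_rw [this]
    rw [integral_indicator measurableSet_Ici, stdP_restrict_Ici (by linarith)]
    simp [hb0.le]
  have e4 : (c ^ (-p)) ^ (1 / p) = c⁻¹ := by
    rw [← Real.rpow_mul hc0.le, neg_mul, mul_one_div_cancel hpq.ne_zero, Real.rpow_neg_one]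
  rw [e1, e2, e3, e4] at h
  have h2 : c * ∫ u, max (Q u - t) 0 ^ (p - 1) ∂stdP ≤ A ^ (1 / q) := by
    rwa [← div_eq_mul_inv, le_div_iff₀ hc0, mul_comm] at h
  calc (c * ∫ u, max (Q u - t) 0 ^ (p - 1) ∂stdP) ^ q ≤ (A ^ (1 / q)) ^ q :=
        Real.rpow_le_rpow (mul_nonneg hc0.le (integral_nonneg fun u =>
          Real.rpow_nonneg (le_max_right _ _) _)) h2 hpq.symm.nonneg
    _ = A := by rw [← Real.rpow_mul hA0, one_div_mul_cancel hpq.symm.ne_zero, Real.rpow_one]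

/-- Some spectral function of norm `c` attains a term of the infimum defining the risk. -/
theorem exists_spectral_attaining (hpq : p.HolderConjugate q) (hc : 1 < c)
    (hQ : MemLp Q (ENNReal.ofReal p) stdP) (hm : MonotoneOn Q (Ioo 0 1))
    (hr : ∀ u ∈ Ioo (0 : ℝ) 1, ContinuousWithinAt Q (Ici u) u) :
    ∃ σ ∈ spectralSphere c (ENNReal.ofReal q), ∃ t : ℝ,
      ∫ u, σ u * Q u ∂stdP = t + c * (∫ u, max (Q u - t) 0 ^ p ∂stdP) ^ (1 / p) := by
  have hc0 : 0 < c := by linarith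
  have hb1 : c ^ (-p) < 1 := Real.rpow_lt_one_of_one_lt_of_neg hc (by linarith [hpq.pos])
  have hb0 : 0 < c ^ (-p) := Real.rpow_pos_of_pos hc0 _
  have hbmem : 1 - c ^ (-p) ∈ Ioo (0 : ℝ) 1 := ⟨by linarith, by linarith⟩
  -- Formally `A' = -pB`, so `t + c A^(1/p)` is stationary where `A = (cB)^q`; this is also the
  -- condition that `(Q-t)₊^(p-1) / B` have norm `c`.
  let A : ℝ → ℝ := fun t => ∫ u, max (Q u - t) 0 ^ p ∂stdP
  let B : ℝ → ℝ := fun t => ∫ u, max (Q u - t) 0 ^ (p - 1) ∂stdP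
  have hAi : ∀ t, Integrable (fun u => max (Q u - t) 0 ^ p) stdP := fun t =>
    integrable_rpow_of_memLp hpq.pos (memLp_posPart_sub hQ t)
      (Eventually.of_forall fun u => le_max_right _ _)
  have hBi : ∀ t, Integrable (fun u => max (Q u - t) 0 ^ (p - 1)) stdP := fun t =>
    integrable_rpow_of_memLp hpq.sub_one_pos (memLp_posPart_sub (memLp_sub_one hQ) t)
      (Eventually.of_forall fun u => le_max_right _ _)
  have hA0 : ∀ t, 0 ≤ A t := fun t =>
    integral_nonneg fun u => Real.rpow_nonneg (le_max_right _ _) _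
  have hB0 : ∀ t, 0 ≤ B t := fun t =>
    integral_nonneg fun u => Real.rpow_nonneg (le_max_right _ _) _
  set T := Q (1 - c ^ (-p)) with hT
  rcases (hA0 T).eq_or_lt with hAT | hAT
  -- If `A T = 0`, then `Q ≤ T` almost everywhere, while `Q ≥ T` on the tail by monotonicity; hence
  -- `Q = T` there.
  · refine ⟨_, tail_mem_spectralSphere hpq hc, T, ?_⟩
    have hz : ∀ᵐ u ∂stdP, Q u ≤ T := by
      have := (integral_eq_zero_iff_of_nonneg (fun u => Real.rpow_nonneg (le_max_right _ _) _)
        (hAi T)).1 hAT.symm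
      filter_upwards [this] with u hu
      have hu' : max (Q u - T) 0 ^ p = 0 := hu
      have := (Real.rpow_eq_zero (le_max_right _ _) hpq.ne_zero).1 hu'
      linarith [le_max_left (Q u - T) 0]
    change _ = T + c * (A T) ^ (1 / p)
    rw [← hAT, Real.zero_rpow hpq.one_div_ne_zero, mul_zero, add_zero]
    have : ∫ u, (Ici (1 - c ^ (-p))).indicator (fun _ => c ^ p) u * Q u ∂stdP =
        ∫ u, (Ici (1 - c ^ (-p))).indicator (fun _ => c ^ p * T) u ∂stdP := by
      refine integral_congr_ae ?_
      filter_upwards [hz, ae_mem_Ioo] with u hu hu1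
      by_cases h : u ∈ Ici (1 - c ^ (-p))
      · rw [indicator_of_mem h, indicator_of_mem h, le_antisymm hu (hm hbmem hu1 h)]
      · rw [indicator_of_notMem h, indicator_of_notMem h, zero_mul]
    rw [this, integral_indicator measurableSet_Ici, stdP_restrict_Ici hbmem.1.le]
    simp only [integral_const, MeasurableSet.univ, measureReal_restrict_apply, univ_inter,
      Real.volume_real_Ioo_of_le hbmem.2.le, smul_eq_mul, sub_sub_cancel]
    rw [← mul_assoc, ← Real.rpow_add hc0]
    simp
  · have hGT : (c * B T) ^ q ≤ A T := by
      refine integral_le_of_tail hpq hc hQ ?_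
      filter_upwards [ae_mem_Ioo] with u hu hlt
      exact hm hu hbmem hlt.le
    obtain ⟨t₀, ht₀, hlt⟩ := exists_le_integral_lt hpq hc hQ T
    have hcont : ContinuousOn (fun t => A t - (c * B t) ^ q) (Icc t₀ T) := by
      have hcA := continuous_integral_posPart_rpow hpq.pos hQ
      have hcB := continuous_integral_posPart_rpow hpq.sub_one_pos (memLp_sub_one hQ)
      exact (hcA.sub ((continuous_const.mul hcB).rpow_const
        fun _ => Or.inr hpq.symm.nonneg)).continuousOn
    obtain ⟨t, ⟨_, htT⟩, ht⟩ := intermediate_value_Icc ht₀ hcont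
      (show (0 : ℝ) ∈ Icc _ _ from ⟨sub_nonpos.2 hlt.le, sub_nonneg.2 hGT⟩)
    have hABt : A t = (c * B t) ^ q := sub_eq_zero.1 ht
    -- `A` is nonincreasing and `t ≤ T`. Positivity of `A t` then passes to `B t` through the
    -- stationarity equation.
    have hAt : 0 < A t := by
      refine hAT.trans_le (integral_mono (hAi T) (hAi t) fun u => ?_)
      exact Real.rpow_le_rpow (le_max_right _ _)
        (max_le_max (by linarith) le_rfl) hpq.nonneg
    have hBt : 0 < B t := by
      refine lt_of_le_of_ne (hB0 t) fun h => ?_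
      rw [hABt, ← h, mul_zero, Real.zero_rpow hpq.symm.ne_zero] at hAt
      exact lt_irrefl _ hAt
    let g : ℝ → ℝ := fun u => max (Q u - t) 0 ^ (p - 1) / B t
    have hg0 : ∀ u, 0 ≤ g u := fun u =>
      div_nonneg (Real.rpow_nonneg (le_max_right _ _) _) hBt.le
    have hgi : Integrable g stdP := (hBi t).div_const _
    have hg1 : ∫ u, g u ∂stdP = 1 := by
      simp only [g]
      rw [integral_div]
      exact div_self hBt.ne'
    have hgm : MonotoneOn g (Ioo 0 1) := by
      intro u hu v hv huv
      refine div_le_div_of_nonneg_right ?_ hBt.le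
      exact Real.rpow_le_rpow (le_max_right _ _)
        (max_le_max (by linarith [hm hu hv huv]) le_rfl) hpq.sub_one_pos.le
    have hgr : ∀ u ∈ Ioo (0 : ℝ) 1, ContinuousWithinAt g (Ici u) u := by
      intro u hu
      have h1 := (((hr u hu).sub_const t).max continuousWithinAt_const (g := fun _ => (0 : ℝ)))
      exact (h1.rpow_const (Or.inr hpq.sub_one_pos.le)).div_const _
    -- `g` is controlled only on the open interval; `quantile g` is a version of it with the
    -- required regularity at `0` as well.
    have hσ : quantile g =ᵐ[stdP] g := by
      filter_upwards [ae_mem_Ioo] with u hu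
      exact quantile_eq_self hgm hgr hu
    have hgq : ∀ u, g u ^ q = max (Q u - t) 0 ^ p / B t ^ q := fun u => by
      simp only [g]
      rw [Real.div_rpow (Real.rpow_nonneg (le_max_right _ _) _) hBt.le,
        rpow_sub_one_rpow hpq.symm (le_max_right _ _)]
    have hgL : MemLp g (ENNReal.ofReal q) stdP := by
      refine memLp_of_integrable_rpow hpq.symm.pos hgi.1 (Eventually.of_forall hg0) ?_
      simp_rw [hgq]
      exact (hAi t).div_const _
    have hgn : ∫ u, g u ^ q ∂stdP = c ^ q := by
      simp_rw [hgq]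
      rw [integral_div]
      change A t / B t ^ q = c ^ q
      rw [hABt, Real.mul_rpow hc0.le hBt.le,
        mul_div_cancel_right₀ _ (Real.rpow_pos_of_pos hBt q).ne']
    refine ⟨quantile g, (mem_spectralSphere_iff hpq.symm.pos hc0.le).2
      ⟨isSpectral_quantile hgi (Eventually.of_forall hg0) hg1, hgL.ae_eq hσ.symm, ?_⟩, t, ?_⟩
    · rw [← hgn]
      refine integral_congr_ae ?_
      filter_upwards [hσ] with u hu
      rw [hu]
    · have e1 : ∫ u, quantile g u * Q u ∂stdP = ∫ u, (g u * t + max (Q u - t) 0 ^ p / B t)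
          ∂stdP := by
        refine integral_congr_ae ?_
        filter_upwards [hσ] with u hu
        rw [hu]
        simp only [g]
        rw [← mul_rpow_sub_one hpq.lt (le_max_right (Q u - t) 0)]
        rcases le_total (Q u - t) 0 with h | h
        · rw [max_eq_right h, Real.zero_rpow hpq.sub_one_ne_zero]
          simp
        · rw [max_eq_left h]
          ring
      rw [e1, integral_add (hgi.mul_const t) ((hAi t).div_const _), integral_mul_const, hg1,
        integral_div, one_mul]
      congr 1
      change A t / B t = c * A t ^ (1 / p)
      have h1 : c * B t = A t ^ (1 / q) := by
        rw [hABt, ← Real.rpow_mul (by positivity), mul_one_div_cancel hpq.symm.ne_zero,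
          Real.rpow_one]
      have h2 : A t ^ (1 / p) * A t ^ (1 / q) = A t := by
        rw [← Real.rpow_add hAt, hpq.one_div_add_one_div, div_one, Real.rpow_one]
      rw [div_eq_iff hBt.ne', mul_right_comm, h1, mul_comm, h2]

end Attainment

/-! ### Norm bounds from monotone test functions -/

section NormBound

variable {p q c : ℝ} {σ : ℝ → ℝ}

/-- The norm of a spectral function is determined by bounded nondecreasing test functions. -/
theorem norm_le_of_test (hpq : p.HolderConjugate q) (hc : 0 ≤ c) (hσ : IsSpectral σ)
    (H : ∀ W : ℝ → ℝ, MonotoneOn W (Ioo 0 1) →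
      (∀ u ∈ Ioo (0 : ℝ) 1, ContinuousWithinAt W (Ici u) u) →
      (∃ K, ∀ u ∈ Ioo (0 : ℝ) 1, 0 ≤ W u ∧ W u ≤ K) →
      ∫ u, σ u * W u ∂stdP ≤ c * (∫ u, W u ^ p ∂stdP) ^ (1 / p)) :
    MemLp σ (ENNReal.ofReal q) stdP ∧ ∫ u, σ u ^ q ∂stdP ≤ c ^ q := by
  have hq := hpq.symm.pos
  have hq1 := hpq.symm.sub_one_pos
  have hσi : Integrable σ stdP := by
    rw [stdP_eq_Ico]
    exact hσ.integrable
  have h0 : ∀ u ∈ Ioo (0 : ℝ) 1, 0 ≤ σ u := fun u hu => hσ.nonneg u ⟨hu.1.le, hu.2⟩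
  -- With `m = min σ k`, the test function `m^(q-1)` is bounded, nondecreasing and right-continuous.
  -- It gives `∫ m^q ≤ ∫ σ m^(q-1) ≤ c (∫ m^q)^(1/p)` with finite integrals; monotone convergence in
  -- `k` follows.
  let m : ℕ → ℝ → ℝ := fun k u => min (σ u) k
  have hm0 : ∀ k, ∀ u ∈ Ioo (0 : ℝ) 1, 0 ≤ m k u := fun k u hu =>
    le_min (h0 u hu) k.cast_nonneg
  have hmm : ∀ k, AEMeasurable (m k) stdP := fun k =>
    hσ.aemeasurable.min aemeasurable_const
  have hmi : ∀ k, Integrable (fun u => m k u ^ q) stdP := by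
    intro k
    refine Integrable.of_bound (C := (k : ℝ) ^ q) ((hmm k).pow_const q).aestronglyMeasurable ?_
    filter_upwards [ae_mem_Ioo] with u hu
    rw [Real.norm_of_nonneg (Real.rpow_nonneg (hm0 k u hu) _)]
    exact Real.rpow_le_rpow (hm0 k u hu) (min_le_right _ _) hq.le
  have hmc : ∀ k, ∫ u, m k u ^ q ∂stdP ≤ c ^ q := by
    intro k
    refine le_rpow_of_le_mul_rpow hpq hc (integral_nonneg_of_ae ?_) ?_
    · filter_upwards [ae_mem_Ioo] with u hu
      exact Real.rpow_nonneg (hm0 k u hu) _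
    have hW := H (fun u => m k u ^ (q - 1)) ?_ ?_ ⟨(k : ℝ) ^ (q - 1), fun u hu =>
      ⟨Real.rpow_nonneg (hm0 k u hu) _,
        Real.rpow_le_rpow (hm0 k u hu) (min_le_right _ _) hq1.le⟩⟩
    · have e : ∫ u, (m k u ^ (q - 1)) ^ p ∂stdP = ∫ u, m k u ^ q ∂stdP := by
        refine integral_congr_ae ?_
        filter_upwards [ae_mem_Ioo] with u hu
        rw [rpow_sub_one_rpow hpq (hm0 k u hu)]
      rw [e] at hW
      refine le_trans (integral_mono_ae (hmi k) ?_ ?_) hW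
      · refine hσi.mul_bdd (c := (k : ℝ) ^ (q - 1)) ((hmm k).pow_const _).aestronglyMeasurable ?_
        filter_upwards [ae_mem_Ioo] with u hu
        rw [Real.norm_of_nonneg (Real.rpow_nonneg (hm0 k u hu) _)]
        exact Real.rpow_le_rpow (hm0 k u hu) (min_le_right _ _) hq1.le
      · filter_upwards [ae_mem_Ioo] with u hu
        rw [← mul_rpow_sub_one hpq.symm.lt (hm0 k u hu)]
        exact mul_le_mul_of_nonneg_right (min_le_left _ _) (Real.rpow_nonneg (hm0 k u hu) _)
    · intro u hu v hv huv
      exact Real.rpow_le_rpow (hm0 k u hu) (min_le_min_right _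
        (hσ.mono ⟨hu.1.le, hu.2⟩ ⟨hv.1.le, hv.2⟩ huv)) hq1.le
    · intro u hu
      exact ((hσ.rightCont u ⟨hu.1.le, hu.2⟩).min continuousWithinAt_const).rpow_const
        (Or.inr hq1.le)
  have hlim : Tendsto (fun k => ∫⁻ u, ENNReal.ofReal (m k u ^ q) ∂stdP) atTop
      (𝓝 (∫⁻ u, ENNReal.ofReal (σ u ^ q) ∂stdP)) := by
    refine lintegral_tendsto_of_tendsto_of_monotone
      (fun k => ((hmm k).pow_const q).ennreal_ofReal) ?_ ?_
    · filter_upwards [ae_mem_Ioo] with u hu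
      intro k l hkl
      refine ENNReal.ofReal_le_ofReal (Real.rpow_le_rpow (hm0 k u hu) ?_ hq.le)
      exact min_le_min_left _ (by exact_mod_cast hkl)
    · refine Eventually.of_forall fun u => ?_
      refine tendsto_const_nhds.congr' ?_
      obtain ⟨N, hN⟩ := exists_nat_gt (σ u)
      filter_upwards [eventually_ge_atTop N] with k hk
      have : (N : ℝ) ≤ k := by exact_mod_cast hk
      simp only [m]
      rw [min_eq_left (by linarith)]
  have hle : ∫⁻ u, ENNReal.ofReal (σ u ^ q) ∂stdP ≤ ENNReal.ofReal (c ^ q) := by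
    refine le_of_tendsto' hlim fun k => ?_
    rw [← ofReal_integral_eq_lintegral_ofReal (hmi k)]
    · exact ENNReal.ofReal_le_ofReal (hmc k)
    · filter_upwards [ae_mem_Ioo] with u hu
      exact Real.rpow_nonneg (hm0 k u hu) _
  have hpow0 : 0 ≤ᵐ[stdP] fun u => σ u ^ q := by
    filter_upwards [ae_mem_Ioo] with u hu
    exact Real.rpow_nonneg (h0 u hu) _
  have hpowm : AEStronglyMeasurable (fun u => σ u ^ q) stdP :=
    (hσ.aemeasurable.pow_const q).aestronglyMeasurable
  have hint : Integrable (fun u => σ u ^ q) stdP := by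
    refine ⟨hpowm, ?_⟩
    rw [hasFiniteIntegral_iff_ofReal hpow0]
    exact hle.trans_lt ENNReal.ofReal_lt_top
  refine ⟨memLp_of_integrable_rpow hq hσ.aemeasurable.aestronglyMeasurable hσ.ae_nonneg hint, ?_⟩
  rw [integral_eq_lintegral_of_nonneg_ae hpow0 hpowm]
  exact ENNReal.toReal_le_of_le_ofReal (Real.rpow_nonneg hc q) hle

end NormBound

/-! ### Mixtures of Average Value-at-Risk and norms of their spectral functions -/

section Measures

variable {p q c : ℝ}

/-- The Fubini identity applied to the quantile function. The default value of `avar` at `α = 1` is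
harmless, as `μ` has no mass there. -/
theorem integral_avar_eq (μ : KMeasure) {Z : ℝ → ℝ} (hZ : Integrable Z stdP)
    (hi : Integrable (fun u => spectrumOf μ u * quantile Z u) stdP) :
    Integrable (fun α : unitInterval => avar α Z) μ.meas ∧
      ∫ α : unitInterval, avar α Z ∂μ.meas = ∫ u, spectrumOf μ u * quantile Z u ∂stdP := by
  have h := integral_spectrumOf_mul μ (integrable_quantile hZ).1 hi
  have e : (fun α : unitInterval => (1 - (α : ℝ))⁻¹ * ∫ u in Ioo (α : ℝ) 1, quantile Z u)
      =ᵐ[μ.meas] fun α : unitInterval => avar α Z := by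
    filter_upwards [μ.ae_lt_one] with α hα
    rw [avar_eq_integral_quantile α.2.1 hα hZ]
  exact ⟨h.1.congr e, by rw [← integral_congr_ae e, h.2]⟩

theorem memLp_quantile {r : ℝ≥0∞} {Z : ℝ → ℝ} (hZ : MemLp Z r stdP) :
    MemLp (quantile Z) r stdP :=
  (identDistrib_quantile hZ.1.aemeasurable).memLp_iff.2 hZ

theorem integral_avar_eq_of_memLp (hpq : p.HolderConjugate q) (μ : KMeasure)
    (hμ : MemLp (spectrumOf μ) (ENNReal.ofReal q) stdP) {Z : ℝ → ℝ}
    (hZ : MemLp Z (ENNReal.ofReal p) stdP) :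
    Integrable (fun α : unitInterval => avar α Z) μ.meas ∧
      ∫ α : unitInterval, avar α Z ∂μ.meas = ∫ u, spectrumOf μ u * quantile Z u ∂stdP :=
  integral_avar_eq μ (hZ.integrable (one_le_ofReal hpq.lt))
    (integrable_mul_of_memLp hpq hμ (memLp_quantile hZ))

theorem eqOn_Ico_ae {f g : ℝ → ℝ} (h : EqOn f g (Ico 0 1)) : f =ᵐ[stdP] g := by
  filter_upwards [ae_mem_Ioo] with u hu
  exact h ⟨hu.1.le, hu.2⟩

theorem mem_measuresOf_iff (hq : 0 < q) (hc : 0 ≤ c) (μ : KMeasure) :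
    μ ∈ measuresOf (spectralSphere c (ENNReal.ofReal q)) ↔
      MemLp (spectrumOf μ) (ENNReal.ofReal q) stdP ∧ ∫ u, spectrumOf μ u ^ q ∂stdP = c ^ q := by
  constructor
  · rintro ⟨σ, hσ, h⟩
    obtain ⟨_, h1, h2⟩ := (mem_spectralSphere_iff hq hc).1 hσ
    have he := eqOn_Ico_ae h
    refine ⟨h1.ae_eq he.symm, ?_⟩
    rw [← h2]
    refine integral_congr_ae ?_
    filter_upwards [he] with u hu
    rw [hu]
  · rintro ⟨h1, h2⟩
    exact ⟨_, (mem_spectralSphere_iff hq hc).2 ⟨isSpectral_spectrumOf μ, h1, h2⟩,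
      fun _ _ => rfl⟩

/-- Every measure of a Kusuoka set has a spectral function of norm at most `c`. -/
theorem norm_spectrumOf_le_of_kusuoka (hpq : p.HolderConjugate q) (hc : 1 < c)
    {M : Set KMeasure} (hM : IsKusuokaSet (higherOrderRisk c (ENNReal.ofReal p)) M)
    {μ : KMeasure} (hμ : μ ∈ M) :
    MemLp (spectrumOf μ) (ENNReal.ofReal q) stdP ∧ ∫ u, spectrumOf μ u ^ q ∂stdP ≤ c ^ q := by
  refine norm_le_of_test hpq (by linarith) (isSpectral_spectrumOf μ) ?_
  rintro W hWm hWr ⟨K, hK⟩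
  have hWb : ∀ᵐ u ∂stdP, ‖W u‖ ≤ K := by
    filter_upwards [ae_mem_Ioo] with u hu
    rw [Real.norm_of_nonneg (hK u hu).1]
    exact (hK u hu).2
  have hWs := (aemeasurable_of_monotoneOn hWm).aestronglyMeasurable
  have hW : MemLp W (ENNReal.ofReal p) stdP := MemLp.of_bound hWs K hWb
  have hW0 : ∀ᵐ u ∂stdP, 0 ≤ W u := by
    filter_upwards [ae_mem_Ioo] with u hu
    exact (hK u hu).1
  -- A nondecreasing right-continuous `W` is its own quantile function, so its pairing with
  -- `spectrumOf μ` is a mixture bounded by the risk of `W`, hence by `c‖W‖_p`.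
  have hquant : quantile (hW.toLp W) =ᵐ[stdP] W := by
    rw [quantile_congr hW.coeFn_toLp]
    filter_upwards [ae_mem_Ioo] with u hu
    exact quantile_eq_self hWm hWr hu
  have hi : Integrable (fun u => spectrumOf μ u * quantile (hW.toLp W) u) stdP := by
    refine ((integrable_spectrumOf μ).1.mul_bdd hWs hWb).congr ?_
    filter_upwards [hquant] with u hu
    rw [hu]
  have h1 := (integral_avar_eq μ ((Lp.memLp (hW.toLp W)).integrable (one_le_ofReal hpq.lt)) hi).2
  have h2 := (hM (hW.toLp W)).2.1 (mem_image_of_mem _ hμ)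
  refine le_trans (le_of_eq ?_) (h2.trans (risk_le_of_nonneg hpq.lt hc hW hW0))
  rw [h1]
  refine integral_congr_ae ?_
  filter_upwards [hquant] with u hu
  rw [hu]

end Measures

/-! ### Weak closure of the set of measures -/

section Closure

variable {p q c K : ℝ} {W : ℝ → ℝ}

/-- The tail averages of `W`, with the value `L` at `1`. -/
noncomputable def tailAverage (W : ℝ → ℝ) (L : ℝ) (α : unitInterval) : ℝ :=
  if (α : ℝ) < 1 then (1 - (α : ℝ))⁻¹ * ∫ u in Ioo (α : ℝ) 1, W u else L

/-- Below `1` this is continuity of a primitive. At `1`, tail averages beyond a level `v` lie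
between `W v` and the supremum `L`, so `L` is the correct limit. -/
theorem continuous_tailAverage (hm : MonotoneOn W (Ioo 0 1))
    (hK : ∀ u ∈ Ioo (0 : ℝ) 1, 0 ≤ W u ∧ W u ≤ K) :
    Continuous (tailAverage W (sSup (W '' Ioo 0 1))) := by
  set L := sSup (W '' Ioo 0 1) with hL
  have hbdd : BddAbove (W '' Ioo 0 1) := ⟨K, by
    rintro _ ⟨u, hu, rfl⟩
    exact (hK u hu).2⟩
  have hne : (W '' Ioo 0 1).Nonempty := ⟨_, mem_image_of_mem W ⟨one_half_pos, one_half_lt_one⟩⟩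
  have hWi : IntegrableOn W (Ioo 0 1) := by
    rw [IntegrableOn, ← stdP_eq_Ioo]
    refine Integrable.of_bound (C := K) (aemeasurable_of_monotoneOn hm).aestronglyMeasurable ?_
    filter_upwards [ae_mem_Ioo] with u hu
    rw [Real.norm_of_nonneg (hK u hu).1]
    exact (hK u hu).2
  have hWα : ∀ α : unitInterval, IntegrableOn W (Ioo (α : ℝ) 1) := fun α =>
    hWi.mono_set (Ioo_subset_Ioo_left α.2.1)
  have hle : ∀ α, tailAverage W L α ≤ L := by
    intro α
    unfold tailAverage
    split_ifs with h
    · rw [inv_mul_le_iff₀ (by linarith)]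
      calc ∫ u in Ioo (α : ℝ) 1, W u ≤ ∫ _ in Ioo (α : ℝ) 1, L := by
            refine setIntegral_mono_on (hWα α) (integrable_const _) measurableSet_Ioo ?_
            intro u hu
            exact le_csSup hbdd (mem_image_of_mem W ⟨α.2.1.trans_lt hu.1, hu.2⟩)
        _ = (1 - (α : ℝ)) * L := by simp [Real.volume_real_Ioo_of_le h.le]
    · exact le_rfl
  have hge : ∀ v ∈ Ioo (0 : ℝ) 1, ∀ α : unitInterval, v < α → W v ≤ tailAverage W L α := by
    intro v hv α hvα
    unfold tailAverage
    split_ifs with h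
    · rw [le_inv_mul_iff₀ (by linarith)]
      calc (1 - (α : ℝ)) * W v = ∫ _ in Ioo (α : ℝ) 1, W v := by
            simp [Real.volume_real_Ioo_of_le h.le]
        _ ≤ ∫ u in Ioo (α : ℝ) 1, W u := by
            refine setIntegral_mono_on (integrable_const _) (hWα α) measurableSet_Ioo ?_
            intro u hu
            exact hm hv ⟨α.2.1.trans_lt hu.1, hu.2⟩ (hvα.trans hu.1).le
    · exact le_csSup hbdd (mem_image_of_mem W hv)
  rw [continuous_iff_continuousAt]
  intro α
  by_cases hα : (α : ℝ) < 1
  · let V : ℝ → ℝ := (Ioo (0 : ℝ) 1).indicator W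
    have hVi : Integrable V := hWi.integrable_indicator measurableSet_Ioo
    have hprim : Continuous fun b : ℝ => ∫ x in (1 : ℝ)..b, V x :=
      intervalIntegral.continuous_primitive (fun a b => hVi.intervalIntegrable) 1
    have hev : ∀ᶠ β : unitInterval in 𝓝 α,
        (1 - (β : ℝ))⁻¹ * (-∫ x in (1 : ℝ)..(β : ℝ), V x) = tailAverage W L β := by
      filter_upwards [(isOpen_lt continuous_subtype_val continuous_const).mem_nhds hα]
        with β hβ
      have hβ' : (β : ℝ) < 1 := hβ
      rw [tailAverage, if_pos hβ', ← intervalIntegral.integral_symm,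
        intervalIntegral.integral_of_le hβ'.le, integral_Ioc_eq_integral_Ioo]
      congr 1
      refine setIntegral_congr_fun measurableSet_Ioo fun u hu => ?_
      exact indicator_of_mem (show u ∈ Ioo (0 : ℝ) 1 from ⟨β.2.1.trans_lt hu.1, hu.2⟩) W
    refine ContinuousAt.congr ?_ hev
    refine ContinuousAt.mul ?_ (hprim.comp continuous_subtype_val).neg.continuousAt
    exact ContinuousAt.inv₀ (by fun_prop) (by linarith)
  · have hval : tailAverage W L α = L := if_neg hα
    rw [ContinuousAt, hval, tendsto_order]
    constructor
    · intro a ha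
      obtain ⟨_, ⟨v, hv, rfl⟩, hav⟩ := exists_lt_of_lt_csSup hne ha
      filter_upwards [(isOpen_lt continuous_const continuous_subtype_val).mem_nhds
        (show v < (α : ℝ) from hv.2.trans_le (not_lt.1 hα))] with β hβ
      exact hav.trans_le (hge v hv β hβ)
    · intro a ha
      exact Eventually.of_forall fun β => (hle β).trans_lt ha

/-- The pairing is the `μ`-integral of the tail average of `W`, a continuous function on the compact
interval, which is what weak convergence tests. -/
theorem continuous_integral_spectrumOf_mul (hm : MonotoneOn W (Ioo 0 1))
    (hK : ∀ u ∈ Ioo (0 : ℝ) 1, 0 ≤ W u ∧ W u ≤ K) :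
    Continuous fun μ : KMeasure => ∫ u, spectrumOf μ u * W u ∂stdP := by
  let h : C(unitInterval, ℝ) := ⟨_, continuous_tailAverage hm hK⟩
  have e : (fun μ : KMeasure => ∫ u, spectrumOf μ u * W u ∂stdP) = fun μ : KMeasure =>
      ∫ α, BoundedContinuousFunction.mkOfCompact h α ∂(μ.1 : Measure unitInterval) := by
    ext μ
    have hWs := (aemeasurable_of_monotoneOn hm).aestronglyMeasurable
    have hi : Integrable (fun u => spectrumOf μ u * W u) stdP := by
      refine (integrable_spectrumOf μ).1.mul_bdd (c := K) hWs ?_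
      filter_upwards [ae_mem_Ioo] with u hu
      rw [Real.norm_of_nonneg (hK u hu).1]
      exact (hK u hu).2
    rw [← (integral_spectrumOf_mul μ hWs hi).2]
    refine integral_congr_ae ?_
    filter_upwards [μ.ae_lt_one] with α hα
    exact (if_pos hα).symm
  rw [e]
  exact (ProbabilityMeasure.continuous_integral_boundedContinuousFunction _).comp
    continuous_subtype_val

/-- The norm bound passes to the closure. -/
theorem norm_spectrumOf_le_of_mem_closure (hpq : p.HolderConjugate q) (hc : 0 ≤ c)
    {μ : KMeasure} (hμ : μ ∈ closure (measuresOf (spectralSphere c (ENNReal.ofReal q)))) :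
    MemLp (spectrumOf μ) (ENNReal.ofReal q) stdP ∧ ∫ u, spectrumOf μ u ^ q ∂stdP ≤ c ^ q := by
  refine norm_le_of_test hpq hc (isSpectral_spectrumOf μ) ?_
  rintro W hWm hWr ⟨K, hK⟩
  have hWs := (aemeasurable_of_monotoneOn hWm).aestronglyMeasurable
  have hWb : ∀ᵐ u ∂stdP, ‖W u‖ ≤ K := by
    filter_upwards [ae_mem_Ioo] with u hu
    rw [Real.norm_of_nonneg (hK u hu).1]
    exact (hK u hu).2
  have hW : MemLp W (ENNReal.ofReal p) stdP := MemLp.of_bound hWs K hWb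
  -- For each fixed `W` the inequality cuts out a closed set of measures; on the sphere it is
  -- Hölder's inequality, taken at `t = 0`.
  refine closure_minimal (t := {μ : KMeasure | ∫ u, spectrumOf μ u * W u ∂stdP ≤
    c * (∫ u, W u ^ p ∂stdP) ^ (1 / p)}) ?_
    (isClosed_le (continuous_integral_spectrumOf_mul hWm hK) continuous_const) hμ
  intro ν hν
  obtain ⟨h1, h2⟩ := (mem_measuresOf_iff hpq.symm.pos hc ν).1 hν
  have h := integral_mul_le_term hpq hc h1 (Eventually.of_forall (spectrumOf_nonneg ν))
    (integrable_spectrumOf ν).2 h2.le hW 0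
  refine h.trans (le_of_eq ?_)
  rw [zero_add]
  congr 2
  refine integral_congr_ae ?_
  filter_upwards [ae_mem_Ioo] with u hu
  rw [sub_zero, max_eq_left (hK u hu).1]

end Closure

/-! ### Maximizing sequences converge weakly to the exposed point -/

section Exposed

variable {p q c K : ℝ} {σ Q : ℝ → ℝ}

/-- Densities of norm at most `c` that nearly maximize the pairing with `σ ^ (q - 1)` cannot have
a larger pairing with `Q` than a perturbation of `σ`. -/
theorem integral_add_mul_le (hpq : p.HolderConjugate q) {η : ℝ → ℝ}
    (hσ : MemLp σ (ENNReal.ofReal q) stdP) (hσ0 : ∀ᵐ u ∂stdP, 0 ≤ σ u)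
    (hη : MemLp η (ENNReal.ofReal q) stdP) (hη0 : ∀ᵐ u ∂stdP, 0 ≤ η u)
    (hle : ∫ u, η u ^ q ∂stdP ≤ ∫ u, σ u ^ q ∂stdP)
    (hQ : MemLp Q (ENNReal.ofReal p) stdP) (hQ0 : ∀ᵐ u ∂stdP, 0 ≤ Q u) {s : ℝ} (hs : 0 < s) :
    ∫ u, η u * σ u ^ (q - 1) ∂stdP + s * ∫ u, η u * Q u ∂stdP ≤
      ∫ u, σ u ^ q ∂stdP + s * ∫ u, (σ u ^ (q - 1) + s * Q u) ^ (p - 1) * Q u ∂stdP := by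
  have hp0 := hpq.pos
  have hq0 := hpq.symm.pos
  have hZ := memLp_rpow_sub_one hpq hσ hσ0
  have hV : MemLp (fun u => σ u ^ (q - 1) + s * Q u) (ENNReal.ofReal p) stdP :=
    hZ.add (hQ.const_mul s)
  have hV0 : ∀ᵐ u ∂stdP, 0 ≤ σ u ^ (q - 1) + s * Q u := by
    filter_upwards [hσ0, hQ0] with u hu hu'
    exact add_nonneg (Real.rpow_nonneg hu _) (mul_nonneg hs.le hu')
  have i1 := integrable_mul_of_memLp hpq hη hZ
  have i2 := integrable_mul_of_memLp hpq hη hQ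
  have i3 := integrable_rpow_of_memLp hq0 hη hη0
  have i4 := integrable_rpow_of_memLp hq0 hσ hσ0
  have i5 := integrable_mul_of_memLp hpq (memLp_rpow_sub_one hpq.symm hV hV0) hQ
  rw [← integral_const_mul, ← integral_const_mul, ← integral_add i1 (i2.const_mul s)]
  have key : ∫ u, (η u * σ u ^ (q - 1) + s * (η u * Q u)) ∂stdP ≤
      ∫ u, ((η u ^ q / q + σ u ^ q / p) +
        s * ((σ u ^ (q - 1) + s * Q u) ^ (p - 1) * Q u)) ∂stdP := by
    refine integral_mono_ae (i1.add (i2.const_mul s))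
      (((i3.div_const q).add (i4.div_const p)).add (i5.const_mul s)) ?_
    filter_upwards [hσ0, hη0, hQ0, hV0] with u hu hu' hu'' hv
    -- With `V = σ^(q-1) + sQ`, Young bounds `ηV` by `η^q/q + V^p/p`; the tangent to `x^p` at `V`
    -- gives `V^p ≤ σ^q + p s V^(p-1) Q`.
    have h1 := Real.young_inequality_of_nonneg hu' hv hpq.symm
    have h2 := tangent_le_rpow hpq.lt (Real.rpow_nonneg hu (q - 1)) hv
    rw [rpow_sub_one_rpow hpq hu] at h2
    have h3 : (σ u ^ (q - 1) + s * Q u) ^ p / p ≤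
        σ u ^ q / p + s * ((σ u ^ (q - 1) + s * Q u) ^ (p - 1) * Q u) := by
      rw [div_add' _ _ _ hp0.ne']
      refine div_le_div_of_nonneg_right ?_ hp0.le
      linarith
    linarith
  refine key.trans ?_
  have i34 : Integrable (fun u => η u ^ q / q + σ u ^ q / p) stdP :=
    (i3.div_const q).add (i4.div_const p)
  rw [integral_add i34 (i5.const_mul s), integral_add (i3.div_const q) (i4.div_const p),
    integral_div, integral_div]
  have h4 : (∫ u, η u ^ q ∂stdP) / q ≤ (∫ u, σ u ^ q ∂stdP) / q :=
    div_le_div_of_nonneg_right hle hq0.le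
  have h5 : (∫ u, σ u ^ q ∂stdP) / q + (∫ u, σ u ^ q ∂stdP) / p = ∫ u, σ u ^ q ∂stdP := by
    have := hpq.symm.inv_add_inv_eq_one
    rw [div_eq_mul_inv, div_eq_mul_inv, ← mul_add, this, mul_one]
  linarith

/-- The base tends to `σ^(q-1)`, whose `(p-1)`-th power is `σ` because `(p-1)(q-1) = 1`. As `Q ≥ 0`,
the integrand at `s = 1` dominates. -/
theorem tendsto_integral_perturbed (hpq : p.HolderConjugate q)
    (hσ : MemLp σ (ENNReal.ofReal q) stdP) (hσ0 : ∀ᵐ u ∂stdP, 0 ≤ σ u)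
    (hQ : MemLp Q (ENNReal.ofReal p) stdP) (hQ0 : ∀ᵐ u ∂stdP, 0 ≤ Q u) :
    Tendsto (fun s : ℝ => ∫ u, (σ u ^ (q - 1) + s * Q u) ^ (p - 1) * Q u ∂stdP) (𝓝[>] 0)
      (𝓝 (∫ u, σ u * Q u ∂stdP)) := by
  have hp1 := hpq.sub_one_pos
  have hZ := memLp_rpow_sub_one hpq hσ hσ0
  have hV0 : ∀ s : ℝ, 0 ≤ s → ∀ᵐ u ∂stdP, 0 ≤ σ u ^ (q - 1) + s * Q u := by
    intro s hs
    filter_upwards [hσ0, hQ0] with u hu hu'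
    exact add_nonneg (Real.rpow_nonneg hu _) (mul_nonneg hs hu')
  have hV : ∀ s : ℝ, MemLp (fun u => σ u ^ (q - 1) + s * Q u) (ENNReal.ofReal p) stdP :=
    fun s => hZ.add (hQ.const_mul s)
  refine tendsto_integral_filter_of_dominated_convergence
    (fun u => (σ u ^ (q - 1) + 1 * Q u) ^ (p - 1) * Q u) ?_ ?_
    (integrable_mul_of_memLp hpq (memLp_rpow_sub_one hpq.symm (hV 1) (hV0 1 zero_le_one)) hQ) ?_
  · exact Eventually.of_forall fun s =>
      (((hV s).1.aemeasurable.pow_const _).mul hQ.1.aemeasurable).aestronglyMeasurable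
  · filter_upwards [self_mem_nhdsWithin, mem_nhdsWithin_of_mem_nhds (Iio_mem_nhds one_pos)]
      with s hs hs1
    have hs' : 0 < s := hs
    have hs1' : s < 1 := hs1
    filter_upwards [hV0 s hs'.le, hQ0] with u hu hu'
    rw [Real.norm_of_nonneg (mul_nonneg (Real.rpow_nonneg hu _) hu')]
    refine mul_le_mul_of_nonneg_right (Real.rpow_le_rpow hu ?_ hp1.le) hu'
    have := mul_le_mul_of_nonneg_right hs1'.le hu'
    linarith
  · filter_upwards [hσ0] with u hu
    have h : Tendsto (fun s : ℝ => (σ u ^ (q - 1) + s * Q u) ^ (p - 1) * Q u) (𝓝 0)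
        (𝓝 ((σ u ^ (q - 1) + 0 * Q u) ^ (p - 1) * Q u)) := by
      have : Continuous fun s : ℝ => σ u ^ (q - 1) + s * Q u := by fun_prop
      exact ((this.tendsto 0).rpow_const (Or.inr hp1.le)).mul_const _
    rw [zero_mul, add_zero, ← Real.rpow_mul hu, mul_comm (q - 1),
      show (p - 1) * (q - 1) = 1 by linarith [hpq.sub_one_mul_conj], Real.rpow_one] at h
    exact h.mono_left nhdsWithin_le_nhds

variable {η : ℕ → ℝ → ℝ}

/-- A maximizing sequence for the pairing with `σ ^ (q - 1)` converges weakly to `σ`. -/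
theorem tendsto_integral_mul (hpq : p.HolderConjugate q)
    (hσ : MemLp σ (ENNReal.ofReal q) stdP) (hσ0 : ∀ᵐ u ∂stdP, 0 ≤ σ u)
    (hσ1 : ∫ u, σ u ∂stdP = 1)
    (hη : ∀ n, MemLp (η n) (ENNReal.ofReal q) stdP) (hη0 : ∀ n, ∀ᵐ u ∂stdP, 0 ≤ η n u)
    (hη1 : ∀ n, ∫ u, η n u ∂stdP = 1)
    (hle : ∀ n, ∫ u, η n u ^ q ∂stdP ≤ ∫ u, σ u ^ q ∂stdP)
    (hmax : ∀ a < ∫ u, σ u ^ q ∂stdP,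
      ∀ᶠ n in atTop, a < ∫ u, η n u * σ u ^ (q - 1) ∂stdP)
    (hQm : AEStronglyMeasurable Q stdP) (hQK : ∀ᵐ u ∂stdP, |Q u| ≤ K) :
    Tendsto (fun n => ∫ u, η n u * Q u ∂stdP) atTop (𝓝 (∫ u, σ u * Q u ∂stdP)) := by
  -- One-sided bound for nonnegative tests: fix a small `s`, let the defect in the maximization fall
  -- below `s (a - b)`, and divide the perturbation inequality by `s`.
  have upper : ∀ R : ℝ → ℝ, MemLp R (ENNReal.ofReal p) stdP → (∀ᵐ u ∂stdP, 0 ≤ R u) →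
      ∀ a > ∫ u, σ u * R u ∂stdP, ∀ᶠ n in atTop, ∫ u, η n u * R u ∂stdP < a := by
    intro R hR hR0 a ha
    obtain ⟨b, hb, hba⟩ := exists_between ha
    obtain ⟨s, hsb, hs⟩ := (((tendsto_integral_perturbed hpq hσ hσ0 hR hR0).eventually
      (gt_mem_nhds hb)).and self_mem_nhdsWithin).exists
    have hs' : 0 < s := hs
    have hd : 0 < s * (a - b) := mul_pos hs' (by linarith)
    filter_upwards [hmax (∫ u, σ u ^ q ∂stdP - s * (a - b)) (by linarith)] with n hn
    have h := integral_add_mul_le hpq hσ hσ0 (hη n) (hη0 n) (hle n) hR hR0 hs'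
    have h2 := mul_lt_mul_of_pos_left hsb hs'
    refine lt_of_mul_lt_mul_left ?_ hs'.le
    linarith
  have hQL : MemLp Q (ENNReal.ofReal p) stdP := MemLp.of_bound hQm K hQK
  have hc : ∀ (f : ℝ → ℝ), MemLp f (ENNReal.ofReal q) stdP → ∫ u, f u ∂stdP = 1 →
      ∀ s : ℝ, ∫ u, f u * (K + s * Q u) ∂stdP = K + s * ∫ u, f u * Q u ∂stdP := by
    intro f hf hf1 s
    have hfi : Integrable f stdP := hf.integrable (one_le_ofReal hpq.symm.lt)
    have e : ∀ u, f u * (K + s * Q u) = f u * K + s * (f u * Q u) := fun u => by ring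
    simp_rw [e]
    rw [integral_add (hfi.mul_const K) ((integrable_mul_of_memLp hpq hf hQL).const_mul s),
      integral_mul_const, integral_const_mul, hf1, one_mul]
  -- `K + Q` and `K - Q` are nonnegative, and the constant contributes the same `K` to every
  -- density; the two signs give the two halves of the limit.
  have two : ∀ s : ℝ, |s| = 1 → ∀ a > s * ∫ u, σ u * Q u ∂stdP,
      ∀ᶠ n in atTop, s * ∫ u, η n u * Q u ∂stdP < a := by
    intro s hs a ha
    have h := upper (fun u => K + s * Q u) ((memLp_const K).add (hQL.const_mul s)) (by
      filter_upwards [hQK] with u hu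
      have : |s * Q u| ≤ K := by rwa [abs_mul, hs, one_mul]
      linarith [(abs_le.1 this).1]) (K + a) (by
      rw [hc σ hσ hσ1]
      linarith)
    filter_upwards [h] with n hn
    rw [hc _ (hη n) (hη1 n)] at hn
    linarith
  rw [tendsto_order]
  constructor
  · intro a ha
    filter_upwards [two (-1) (by simp) (-a) (by linarith)] with n hn
    linarith
  · intro a ha
    filter_upwards [two 1 (by simp) a (by linarith)] with n hn
    linarith

end Exposed

/-! ### From spectral functions back to weak convergence of measures -/

section WeakConvergence

open Polynomial

/-- Since `(1 - x) P` vanishes at `1`, the tail average of minus its derivative over `(α, 1)` is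
`P(α)`. Thus the spectral function determines all moments. -/
theorem integral_polynomial_eq (μ : KMeasure) (P : ℝ[X]) :
    ∫ α : unitInterval, P.eval (α : ℝ) ∂μ.meas =
      ∫ u, spectrumOf μ u * -(derivative ((1 - X) * P)).eval u ∂stdP := by
  set R : ℝ[X] := (1 - X) * P with hR
  have hcont : Continuous fun u : ℝ => -(derivative R).eval u := by fun_prop
  obtain ⟨K, hK⟩ := isCompact_Icc.exists_bound_of_continuousOn
    (hcont.continuousOn (s := Icc (0 : ℝ) 1))
  have hi : Integrable (fun u => spectrumOf μ u * -(derivative R).eval u) stdP := by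
    refine (integrable_spectrumOf μ).1.mul_bdd (c := K) hcont.aestronglyMeasurable ?_
    filter_upwards [ae_mem_Ioo] with u hu
    exact hK u ⟨hu.1.le, hu.2.le⟩
  rw [← (integral_spectrumOf_mul μ hcont.aestronglyMeasurable hi).2]
  refine integral_congr_ae ?_
  filter_upwards [μ.ae_lt_one] with α hα
  have h : ∫ u in Ioo (α : ℝ) 1, -(derivative R).eval u = (1 - (α : ℝ)) * P.eval (α : ℝ) := by
    rw [← integral_Ioc_eq_integral_Ioo, ← intervalIntegral.integral_of_le hα.le,
      intervalIntegral.integral_neg, intervalIntegral.integral_eq_sub_of_hasDerivAt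
        (fun x _ => R.hasDerivAt x) ((by fun_prop : Continuous
          fun u : ℝ => (derivative R).eval u).intervalIntegrable _ _)]
    simp [hR]
  rw [h, inv_mul_cancel_left₀ (by linarith)]

/-- Weak convergence of the spectral functions implies weak convergence of the measures. -/
theorem tendsto_of_tendsto_spectrumOf {μ : KMeasure} {ν : ℕ → KMeasure}
    (h : ∀ Q : ℝ → ℝ, Continuous Q →
      Tendsto (fun n => ∫ u, spectrumOf (ν n) u * Q u ∂stdP) atTop
        (𝓝 (∫ u, spectrumOf μ u * Q u ∂stdP))) :
    Tendsto ν atTop (𝓝 μ) := by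
  rw [tendsto_subtype_rng, ProbabilityMeasure.tendsto_iff_forall_integral_tendsto]
  intro f
  rw [Metric.tendsto_atTop]
  intro ε hε
  -- Weierstrass approximation: replacing `f` by `P` costs at most `ε / 3` under every probability
  -- measure.
  obtain ⟨P, hP⟩ := exists_polynomial_near_continuousMap 0 1 f.toContinuousMap (ε / 3)
    (by positivity)
  have hPf : ∀ α : unitInterval, |P.eval (α : ℝ) - f α| ≤ ε / 3 := fun α =>
    ((P.toContinuousMapOn (Icc 0 1) - f.toContinuousMap).norm_coe_le_norm α).trans hP.le
  have hPc : Continuous fun α : unitInterval => P.eval (α : ℝ) := by fun_prop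
  have hclose : ∀ κ : KMeasure,
      |∫ α : unitInterval, P.eval (α : ℝ) ∂κ.meas - ∫ α, f α ∂κ.meas| ≤ ε / 3 := by
    intro κ
    have i1 : Integrable (fun α : unitInterval => P.eval (α : ℝ)) κ.meas :=
      (BoundedContinuousFunction.mkOfCompact ⟨_, hPc⟩).integrable _
    rw [← integral_sub i1 (f.integrable _)]
    have hb : ∀ᵐ α : unitInterval ∂κ.meas, ‖P.eval (α : ℝ) - f α‖ ≤ ε / 3 :=
      Eventually.of_forall fun α => hPf α
    simpa using norm_integral_le_of_norm_le_const hb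
  have hlim := h (fun u => -(derivative ((1 - X) * P)).eval u) (by fun_prop)
  simp only [← integral_polynomial_eq] at hlim
  obtain ⟨N, hN⟩ := Metric.tendsto_atTop.1 hlim (ε / 3) (by positivity)
  refine ⟨N, fun n hn => ?_⟩
  have h1 := hN n hn
  have h2 := hclose (ν n)
  have h3 := hclose μ
  change |∫ α, f α ∂(ν n).meas - ∫ α, f α ∂μ.meas| < ε
  rw [Real.dist_eq] at h1
  rw [abs_lt] at h1 ⊢
  rw [abs_le] at h2 h3
  constructor <;> linarith [h1.1, h1.2, h2.1, h2.2, h3.1, h3.2]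

end WeakConvergence

/-! ### Representation, exposed points and minimality -/

section Main

variable {p q c : ℝ}

theorem identDistrib_quantile_Lp {r : ℝ≥0∞} (Z : Lp ℝ r stdP) :
    IdentDistrib (quantile Z) Z stdP stdP :=
  identDistrib_quantile (Lp.memLp Z).1.aemeasurable

/-- The attaining spectral function meets one term of the infimum, which bounds the risk from above.
Weak duality gives the reverse, so the supremum is a maximum. -/
theorem spectral_representation (hpq : p.HolderConjugate q) (hc : 1 < c)
    (Z : Lp ℝ (ENNReal.ofReal p) stdP) :
    (∀ σ ∈ spectralSphere c (ENNReal.ofReal q),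
      IntegrableOn (fun u => σ u * quantile Z u) (Ioo 0 1)) ∧
    IsGreatest ((fun σ => spectralRisk σ Z) '' spectralSphere c (ENNReal.ofReal q))
      (higherOrderRisk c (ENNReal.ofReal p) Z) := by
  have hc0 : 0 ≤ c := by linarith
  have hQ := memLp_quantile (Lp.memLp Z)
  have hle : ∀ σ ∈ spectralSphere c (ENNReal.ofReal q),
      spectralRisk σ Z ≤ higherOrderRisk c (ENNReal.ofReal p) Z := by
    intro σ hσ
    obtain ⟨h1, h2, h3⟩ := (mem_spectralSphere_iff hpq.symm.pos hc0).1 hσ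
    rw [spectralRisk_eq]
    exact integral_mul_le_risk hpq hc0 h2 h1.ae_nonneg h1.integral_stdP h3.le hQ Z
      (identDistrib_quantile_Lp Z)
  refine ⟨fun σ hσ => ?_, ?_, ?_⟩
  · rw [IntegrableOn, ← stdP_eq_Ioo]
    exact integrable_mul_of_memLp hpq
      ((mem_spectralSphere_iff hpq.symm.pos hc0).1 hσ).2.1 hQ
  · have hm := (Lp.memLp Z).1.aemeasurable
    obtain ⟨σ, hσ, t, ht⟩ := exists_spectral_attaining hpq hc hQ (monotoneOn_quantile hm)
      fun u hu => continuousWithinAt_quantile hm (nonempty_cdfOf_le hm hu.1) hu.2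
    refine ⟨σ, hσ, le_antisymm (hle σ hσ) ?_⟩
    change _ ≤ spectralRisk σ Z
    rw [spectralRisk_eq, ht]
    exact risk_le hpq.lt hc Z (identDistrib_quantile_Lp Z) t
  · rintro _ ⟨σ, hσ, rfl⟩
    exact hle σ hσ

theorem spectralSphere_eq_exposed (hpq : p.HolderConjugate q) (hc : 1 < c) :
    spectralSphere c (ENNReal.ofReal q) =
      {σ | IsSpectral σ ∧ ∃ h : MemLp σ (ENNReal.ofReal q) stdP,
        h.toLp σ ∈ weakStarExposed (ENNReal.ofReal p)
          (dualSet (ENNReal.ofReal q) (higherOrderRisk c (ENNReal.ofReal p)))} := by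
  ext σ
  rw [mem_spectralSphere_iff hpq.symm.pos (by linarith)]
  have key : ∀ h : MemLp σ (ENNReal.ofReal q) stdP,
      ∫ u, h.toLp σ u ^ q ∂stdP = ∫ u, σ u ^ q ∂stdP := fun h => by
    refine integral_congr_ae ?_
    filter_upwards [h.coeFn_toLp] with u hu
    rw [hu]
  constructor
  · rintro ⟨h1, h2, h3⟩
    refine ⟨h1, h2, (mem_weakStarExposed_iff hpq hc _).2 ⟨?_, ?_, ?_⟩⟩
    · filter_upwards [h1.ae_nonneg, h2.coeFn_toLp] with u hu hu'
      rwa [hu']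
    · rw [integral_congr_ae h2.coeFn_toLp, h1.integral_stdP]
    · rw [key, h3]
  · rintro ⟨h1, h2, h3⟩
    refine ⟨h1, h2, ?_⟩
    rw [← key h2]
    exact ((mem_weakStarExposed_iff hpq hc _).1 h3).2.2

/-- Sign, integral and `q`-th moment are invariants of the law, so they pass between `ζ` and its
quantile function. -/
theorem exposed_eq_rearrangements (hpq : p.HolderConjugate q) (hc : 1 < c) :
    weakStarExposed (ENNReal.ofReal p)
        (dualSet (ENNReal.ofReal q) (higherOrderRisk c (ENNReal.ofReal p))) =
      {ζ : Lp ℝ (ENNReal.ofReal q) stdP | ∃ σ ∈ spectralSphere c (ENNReal.ofReal q),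
        IdentDistrib ζ σ stdP stdP} := by
  have hc0 : 0 ≤ c := by linarith
  have hpow : Measurable fun x : ℝ => x ^ q := by fun_prop
  ext ζ
  rw [mem_weakStarExposed_iff hpq hc]
  constructor
  · rintro ⟨h0, h1, h2⟩
    have hζ := Lp.memLp ζ
    have hI := identDistrib_quantile hζ.1.aemeasurable
    refine ⟨quantile ζ, (mem_spectralSphere_iff hpq.symm.pos hc0).2
      ⟨isSpectral_quantile (hζ.integrable (one_le_ofReal hpq.symm.lt)) h0 h1,
        memLp_quantile hζ, ?_⟩, hI.symm⟩
    rw [← h2]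
    exact (hI.comp hpow).integral_eq
  · rintro ⟨σ, hσ, hI⟩
    obtain ⟨h1, h2, h3⟩ := (mem_spectralSphere_iff hpq.symm.pos hc0).1 hσ
    refine ⟨(hI.symm.ae_snd (p := fun x => 0 ≤ x) measurableSet_Ici h1.ae_nonneg),
      by rw [hI.integral_eq, h1.integral_stdP], ?_⟩
    rw [← h3]
    exact (hI.comp hpow).integral_eq

/-- A set of measures between the preimage of the sphere and the preimage of the ball is a
Kusuoka set. -/
theorem isKusuokaSet_of_subset (hpq : p.HolderConjugate q) (hc : 1 < c) {M : Set KMeasure}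
    (hsub : measuresOf (spectralSphere c (ENNReal.ofReal q)) ⊆ M)
    (hM : ∀ μ ∈ M, MemLp (spectrumOf μ) (ENNReal.ofReal q) stdP ∧
      ∫ u, spectrumOf μ u ^ q ∂stdP ≤ c ^ q) :
    IsKusuokaSet (higherOrderRisk c (ENNReal.ofReal p)) M := by
  intro Z
  have hc0 : 0 ≤ c := by linarith
  have hZ := Lp.memLp Z
  have hle : higherOrderRisk c (ENNReal.ofReal p) Z ∈
      upperBounds ((fun μ : KMeasure => ∫ α : unitInterval, avar α Z ∂μ.meas) '' M) := by
    rintro _ ⟨μ, hμ, rfl⟩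
    obtain ⟨h1, h2⟩ := hM μ hμ
    change ∫ α : unitInterval, avar α Z ∂μ.meas ≤ _
    rw [(integral_avar_eq_of_memLp hpq μ h1 hZ).2]
    exact integral_mul_le_risk hpq hc0 h1 (Eventually.of_forall (spectrumOf_nonneg μ))
      (integrable_spectrumOf μ).2 h2 (memLp_quantile hZ) Z (identDistrib_quantile_Lp Z)
  refine ⟨fun μ hμ => (integral_avar_eq_of_memLp hpq μ (hM μ hμ).1 hZ).1,
    IsGreatest.isLUB ⟨?_, hle⟩⟩
  obtain ⟨σ, hσ, hval⟩ := (spectral_representation hpq hc Z).2.1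
  -- The attaining spectral function has a preimage under `𝕋`, which lies in `M` because `M`
  -- contains the preimage of the sphere.
  obtain ⟨μ, hμ⟩ := exists_spectrumOf_eq hσ.1
  have hmem : μ ∈ M := hsub ⟨σ, hσ, hμ⟩
  refine ⟨μ, hmem, ?_⟩
  rw [← hval]
  change ∫ α : unitInterval, avar α Z ∂μ.meas = spectralRisk σ Z
  rw [(integral_avar_eq_of_memLp hpq μ (hM μ hmem).1 hZ).2, spectralRisk_eq]
  refine integral_congr_ae ?_
  filter_upwards [eqOn_Ico_ae hμ] with u hu
  rw [hu]

/-- The measures with spectral function of norm `c` belong to every closed Kusuoka set. -/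
theorem measuresOf_subset_of_isClosed (hpq : p.HolderConjugate q) (hc : 1 < c)
    {M : Set KMeasure} (hM : IsKusuokaSet (higherOrderRisk c (ENNReal.ofReal p)) M)
    (hcl : IsClosed M) : measuresOf (spectralSphere c (ENNReal.ofReal q)) ⊆ M := by
  intro μ hμ
  have hc0 : 0 ≤ c := by linarith
  obtain ⟨hL, hn⟩ := (mem_measuresOf_iff hpq.symm.pos hc0 μ).1 hμ
  have hS := isSpectral_spectrumOf μ
  have h0 : ∀ᵐ u ∂stdP, 0 ≤ spectrumOf μ u := Eventually.of_forall (spectrumOf_nonneg μ)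
  have hZ := memLp_rpow_sub_one hpq hL h0
  have hq1 := hpq.symm.sub_one_pos
  have hquant : quantile (hZ.toLp _) =ᵐ[stdP] fun u => spectrumOf μ u ^ (q - 1) := by
    rw [quantile_congr hZ.coeFn_toLp]
    filter_upwards [ae_mem_Ioo] with u hu
    refine quantile_eq_self (Z := fun u => spectrumOf μ u ^ (q - 1)) ?_ ?_ hu
    · intro v hv w hw hvw
      exact Real.rpow_le_rpow (spectrumOf_nonneg μ v)
        (hS.mono ⟨hv.1.le, hv.2⟩ ⟨hw.1.le, hw.2⟩ hvw) hq1.le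
    · intro v hv
      exact (hS.rightCont v ⟨hv.1.le, hv.2⟩).rpow_const (Or.inr hq1.le)
  have hlub := (hM (hZ.toLp _)).2
  -- The supremum over `M` at the exposing variable `(𝕋μ)^(q-1)` need not be attained, so only a
  -- maximizing sequence is available.
  obtain ⟨x, _, _, hx, hxM⟩ := hlub.exists_seq_monotone_tendsto hlub.nonempty
  choose ν hνM hνx using hxM
  have hν := fun n => norm_spectrumOf_le_of_kusuoka hpq hc hM (hνM n)
  have hval : ∀ n, x n = ∫ u, spectrumOf (ν n) u * spectrumOf μ u ^ (q - 1) ∂stdP := by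
    intro n
    rw [← hνx n]
    change ∫ α : unitInterval, avar α (hZ.toLp _) ∂(ν n).meas = _
    rw [(integral_avar_eq_of_memLp hpq (ν n) (hν n).1 (Lp.memLp (hZ.toLp _))).2]
    refine integral_congr_ae ?_
    filter_upwards [hquant] with u hu
    rw [hu]
  -- The risk of the exposing variable is at least its pairing with `𝕋μ` itself, so the sequence
  -- eventually exceeds every number below `∫ (𝕋μ)^q`.
  have hrisk : ∫ u, spectrumOf μ u ^ q ∂stdP ≤
      higherOrderRisk c (ENNReal.ofReal p) (hZ.toLp _) := by
    refine le_trans (le_of_eq ?_) (integral_mul_le_risk hpq hc0 hL h0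
      (integrable_spectrumOf μ).2 hn.le hZ _ (identDistrib_toLp hZ))
    refine integral_congr_ae (Eventually.of_forall fun u => ?_)
    exact (mul_rpow_sub_one hpq.symm.lt (spectrumOf_nonneg μ u)).symm
  refine hcl.mem_of_tendsto (tendsto_of_tendsto_spectrumOf fun Q hQ => ?_)
    (Eventually.of_forall hνM)
  obtain ⟨K, hK⟩ := isCompact_Icc.exists_bound_of_continuousOn
    (hQ.continuousOn (s := Icc (0 : ℝ) 1))
  refine tendsto_integral_mul (K := K) hpq hL h0 (integrable_spectrumOf μ).2
    (fun n => (hν n).1) (fun n => Eventually.of_forall (spectrumOf_nonneg (ν n)))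
    (fun n => (integrable_spectrumOf (ν n)).2) (fun n => by rw [hn]; exact (hν n).2)
    (fun a ha => ?_) hQ.aestronglyMeasurable ?_
  · filter_upwards [hx.eventually (lt_mem_nhds (ha.trans_le hrisk))] with n h
    rwa [← hval]
  · filter_upwards [ae_mem_Ioo] with u hu
    exact hK u ⟨hu.1.le, hu.2.le⟩

end Main

end Kusuoka

theorem mainTheorem9 (c : ℝ) (hc : 1 < c) (p q : ℝ≥0∞) (hp : 1 < p) (hp' : p < ⊤)
    (hpq : ENNReal.HolderConjugate p q) :
    -- the representation, all integrals being finite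
    (∀ Z : Lp ℝ p Kusuoka.stdP,
      (∀ σ ∈ Kusuoka.spectralSphere c q,
        IntegrableOn (fun u => σ u * Kusuoka.quantile Z u) (Ioo 0 1)) ∧
      IsLUB ((fun σ => Kusuoka.spectralRisk σ Z) '' Kusuoka.spectralSphere c q)
        (Kusuoka.higherOrderRisk c p Z)) ∧
    -- its spectral functions are exactly those that are exposed points of the dual set
    Kusuoka.spectralSphere c q =
      {σ | Kusuoka.IsSpectral σ ∧ ∃ h : MemLp σ q Kusuoka.stdP,
        h.toLp σ ∈ Kusuoka.weakStarExposed p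
          (Kusuoka.dualSet q (Kusuoka.higherOrderRisk c p))} ∧
    -- all exposed points are the rearrangements of these spectral functions
    Kusuoka.weakStarExposed p (Kusuoka.dualSet q (Kusuoka.higherOrderRisk c p)) =
      {ζ : Lp ℝ q Kusuoka.stdP | ∃ σ ∈ Kusuoka.spectralSphere c q,
        ProbabilityTheory.IdentDistrib ζ σ Kusuoka.stdP Kusuoka.stdP} ∧
    -- the associated measures form a Kusuoka set, whose closure is the minimal Kusuoka set
    Kusuoka.IsKusuokaSet (Kusuoka.higherOrderRisk c p)
      (Kusuoka.measuresOf (Kusuoka.spectralSphere c q)) ∧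
    Kusuoka.IsMinimalKusuokaSet (Kusuoka.higherOrderRisk c p)
      (closure (Kusuoka.measuresOf (Kusuoka.spectralSphere c q))) := by
  have hp1 : 1 < p.toReal := by
    rw [← ENNReal.toReal_one]
    exact (ENNReal.toReal_lt_toReal ENNReal.one_ne_top hp'.ne).2 hp
  have hr : p.toReal.HolderConjugate q.toReal := ENNReal.HolderConjugate.toReal hp1
  -- `⊤.toReal = 0` would contradict positivity of the real conjugate exponent.
  have hq' : q ≠ ⊤ := by
    intro h
    have := hr.symm.pos
    simp [h] at this
  obtain ⟨r, rfl⟩ : ∃ r : ℝ, p = ENNReal.ofReal r := ⟨_, (ENNReal.ofReal_toReal hp'.ne).symm⟩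
  obtain ⟨s, rfl⟩ : ∃ s : ℝ, q = ENNReal.ofReal s := ⟨_, (ENNReal.ofReal_toReal hq').symm⟩
  have hrs : r.HolderConjugate s := by
    have h1 := hr.pos
    have h2 := hr.symm.pos
    rw [ENNReal.toReal_pos_iff] at h1 h2
    rwa [ENNReal.toReal_ofReal (ENNReal.ofReal_pos.1 h1.1).le,
      ENNReal.toReal_ofReal (ENNReal.ofReal_pos.1 h2.1).le] at hr
  have hc0 : 0 ≤ c := by linarith
  refine ⟨fun Z => ⟨(Kusuoka.spectral_representation hrs hc Z).1,
    (Kusuoka.spectral_representation hrs hc Z).2.isLUB⟩,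
    Kusuoka.spectralSphere_eq_exposed hrs hc, Kusuoka.exposed_eq_rearrangements hrs hc, ?_, ?_,
    isClosed_closure, fun M hM hcl =>
      closure_minimal (Kusuoka.measuresOf_subset_of_isClosed hrs hc hM hcl) hcl⟩
  · refine Kusuoka.isKusuokaSet_of_subset hrs hc Subset.rfl fun μ hμ => ?_
    obtain ⟨h1, h2⟩ := (Kusuoka.mem_measuresOf_iff hrs.symm.pos hc0 μ).1 hμ
    exact ⟨h1, h2.le⟩
  · exact Kusuoka.isKusuokaSet_of_subset hrs hc subset_closure fun μ hμ =>
      Kusuoka.norm_spectrumOf_le_of_mem_closure hrs hc0 hμ
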